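/- Let $F$ be an absolutely continuous distribution function (df) on $\mathbb{R}$ with probability density function (pdf) $f$, and let $k\ge 1$ be an integer. For a df $G$ put $r(G)=\sup\{x\in\mathbb R: G(x)<1\}\in(-\infty,\infty]$ and $G^-(y)=\inf\{x\in\mathbb R: G(x)\ge y\}$. Say that (sequences) $a_n$, $b_n$, with $a_n>0$ for all large $n$, are norming constants for $(F,G)$ if $\lim_{n\to\infty}F(a_nx+b_n)^n=G(x)$ at every continuity point $x$ of $G$, and write $F\in D_l(G)$ if such norming constants exist. For $\alpha>0$ let $\Phi_\alpha(x)=\exp(-x^{-\alpha})$ for $x>0$ and $0$ for $x\le 0$; $\Psi_\alpha(x)=\exp(-|x|^{\alpha})$ for $x<0$ and $1$ for $x\ge 0$; $\Lambda(x)=\exp(-e^{-x})$. Two dfs $G,H$ are tail equivalent if $r(G)=r(H)$ and $(1-G(x))/(1-H(x))$ tends to a constant in $(0,\infty)$ as $x\uparrow r(G)$. Put $$U_k(x)=k\,\frac{1-F(x)}{-\ln F(x)}-F(x)\sum_{l=1}^{k-1}(k-l)\frac{(-\ln F(x))^{l-1}}{l!}\quad\text{if }0<F(x)<1,$$ $U_k(x)=0$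 if $F(x)=0$, $U_k(x)=1$ if $F(x)=1$, and $H_k(x)=1-(1-F(x))^k$. Then: (a) $U_k$ is a df with $r(U_k)=r(F)$, and it has the pdf $$u_k(x)=\frac{k f(x)}{(-\ln F(x))^2}\Big\{\frac1{F(x)}-\sum_{l=0}^{k}\frac{(-\ln F(x))^l}{l!}\Big\}\quad\text{if }0<F(x)<1,\qquad u_k(x)=0\text{ otherwise.}$$ (b) $\displaystyle\lim_{x\uparrow r(F)}\frac{1-U_k(x)}{(1-F(x))^k}=\frac1{(k+1)!}$, and $U_k$ is tail equivalent to $H_k$. (c) If $F\in D_l(\Phi_\alpha)$ for some $\alpha>0$, then $r(U_k)=r(F)=\infty$ and $U_k\in D_l(\Phi_{k\alpha})$, with norming constants $a_n=F^-\big(1-((k+1)!/n)^{1/k}\big)$, $b_n=0$. (d) If $F\in D_l(\Psi_\alpha)$ for some $\alpha>0$, then $r(U_k)=r(F)<\infty$ and $U_k\in D_l(\Psi_{k\alpha})$, with norming constants $a_n=r(F)-F^-\big(1-((k+1)!/n)^{1/k}\big)$, $b_n=r(F)$. (e) If $F\in D_l(\Lambda)$, then $r(U_k)=r(F)$ and $U_k\in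 D_l(\Lambda)$. Moreover, for every auxiliary function $v$ of $F$, that is, every $v:\mathbb R\to\mathbb R$ that is positive on $\{t\in\mathbb R:t<r(F)\}$ and satisfies $\lim_{t\uparrow r(F)}\frac{1-F(t+v(t)x)}{1-F(t)}=e^{-x}$ for all $x\ge0$, norming constants for $(U_k,\Lambda)$ are $a_n=v(b_n)/k$, $b_n=U_k^-(1-1/n)$. Such a $v$ exists: for all $t\in\mathbb R$ one has $\int_t^{\infty}(1-F(s))\,ds<\infty$, and $v(t)=\frac{1}{1-F(t)}\int_t^{r(F)}(1-F(s))\,ds$ (for $t<r(F)$) is an auxiliary function of $F$. -/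

import Mathlib

open Filter Topology MeasureTheory

/-- `F` is a distribution function (df) on `ℝ`. -/
structure IsDF (F : ℝ → ℝ) : Prop where
  mono : Monotone F
  right_cont : ∀ x, ContinuousWithinAt F (Set.Ici x) x
  tendsto_atBot : Tendsto F atBot (𝓝 0)
  tendsto_atTop : Tendsto F atTop (𝓝 1)

/-- `f` is a probability density function (pdf) of the df `F`; in particular `F` is absolutely
continuous. -/
structure IsPDFOf (f F : ℝ → ℝ) : Prop where
  nonneg : ∀ x, 0 ≤ f x
  integrable : Integrable f
  eq_integral : ∀ x, F x = ∫ t in Set.Iic x, f t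

/-- The right extremity `r(F) = sup {x : F x < 1}`, an extended real number. -/
noncomputable def rightExt (F : ℝ → ℝ) : EReal :=
  sSup ((fun x : ℝ => (x : EReal)) '' {x : ℝ | F x < 1})

/-- The filter on `ℝ` of real `x` tending to `r(F)` from the left: it is `atTop` if `r(F) = ∞`. -/
noncomputable def toRightExt (F : ℝ → ℝ) : Filter ℝ :=
  comap (fun x : ℝ => (x : EReal)) (𝓝[<] (rightExt F))

/-- The generalized inverse `F⁻(y) = inf {x : y ≤ F x}` (used for `0 < y < 1`). -/
noncomputable def genInv (F : ℝ → ℝ) (y : ℝ) : ℝ := sInf {x : ℝ | y ≤ F x}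

/-- `F(a_n x + b_n)^n → G(x)` at all continuity points `x` of `G`. -/
def MaxConverges (F G : ℝ → ℝ) (a b : ℕ → ℝ) : Prop :=
  ∀ x, ContinuousAt G x → Tendsto (fun n : ℕ => F (a n * x + b n) ^ n) atTop (𝓝 (G x))

/-- `F` belongs to the max domain of attraction of `G` under linear normalization. -/
def InMaxDomain (F G : ℝ → ℝ) : Prop :=
  ∃ a b : ℕ → ℝ, (∀ n, 0 < a n) ∧ MaxConverges F G a b

/-- The sequences `a`, `b` (given by formulas that make sense for all large `n`) are norming
constants for `F` and `G`. -/
def AreNormings (F G : ℝ → ℝ) (a b : ℕ → ℝ) : Prop :=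
  (∀ᶠ n in atTop, 0 < a n) ∧ MaxConverges F G a b

/-- The Fréchet law `Φ_α`. -/
noncomputable def frechetDF (α : ℝ) (x : ℝ) : ℝ :=
  if 0 < x then Real.exp (-(x ^ (-α))) else 0

/-- The Weibull law `Ψ_α`. -/
noncomputable def weibullDF (α : ℝ) (x : ℝ) : ℝ :=
  if x < 0 then Real.exp (-(|x| ^ α)) else 1

/-- The Gumbel law `Λ`. -/
noncomputable def gumbelDF (x : ℝ) : ℝ := Real.exp (-Real.exp (-x))

/-- Tail equivalence of two dfs: they have the same right extremity and the ratio of their tails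
tends to a positive finite constant there. -/
def TailEquivalent (G H : ℝ → ℝ) : Prop :=
  rightExt G = rightExt H ∧
    ∃ c : ℝ, 0 < c ∧ Tendsto (fun x => (1 - G x) / (1 - H x)) (toRightExt G) (𝓝 c)

/-- `U_k`, given by its formula where `0 < F x < 1`; it is `0` where `F x = 0`, and where `F x = 1`
the quotient `(1 - F) / (-ln F)` is read as its limit `1`, so that `U_k x = 1`. -/
noncomputable def upperU (F : ℝ → ℝ) (k : ℕ) (x : ℝ) : ℝ :=
  if F x ≤ 0 then 0
  else if 1 ≤ F x then 1
  else (k : ℝ) * ((1 - F x) / (-Real.log (F x)))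
    - F x * ∑ l ∈ Finset.Icc 1 (k - 1),
        ((k : ℝ) - (l : ℝ)) * ((-Real.log (F x)) ^ (l - 1) / (l.factorial : ℝ))

/-- The density `u_k`, given by its formula where `0 < F x < 1` and `0` elsewhere. -/
noncomputable def upperUDensity (F f : ℝ → ℝ) (k : ℕ) (x : ℝ) : ℝ :=
  if 0 < F x ∧ F x < 1 then
    (k : ℝ) * f x / (-Real.log (F x)) ^ 2
      * (1 / F x - ∑ l ∈ Finset.range (k + 1), (-Real.log (F x)) ^ l / (l.factorial : ℝ))
  else 0

/-- `H_k = 1 - (1 - F)^k`. -/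
def powTailDF (F : ℝ → ℝ) (k : ℕ) (x : ℝ) : ℝ := 1 - (1 - F x) ^ k

/-- `v` is an auxiliary function of `F` (for the Gumbel domain): it is positive to the left of
`r(F)` and `(1 - F(t + v(t) x)) / (1 - F(t)) → e^{-x}` as `t ↑ r(F)`, for each `x ≥ 0`. -/
def IsAuxiliary (F v : ℝ → ℝ) : Prop :=
  (∀ t : ℝ, (t : EReal) < rightExt F → 0 < v t) ∧
    ∀ x : ℝ, 0 ≤ x →
      Tendsto (fun t => (1 - F (t + v t * x)) / (1 - F t)) (toRightExt F) (𝓝 (Real.exp (-x)))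

/-- The mean residual life `∫_t^{r(F)} (1 - F(s)) ds / (1 - F(t))` (the integrand vanishes beyond
`r(F)`). -/
noncomputable def meanResidualLife (F : ℝ → ℝ) (t : ℝ) : ℝ :=
  (∫ s in Set.Ioi t, (1 - F s)) / (1 - F t)

/-! With N(x) = x - k + e^{-x} ∑_{l<k} (k-l) x^l/l!, one has U_k = K ∘ F, where 1 - K(p) = N(L)/L
and L = -ln p. Since N(0) = 0 and N' = 1 - e^{-x} ∑_{l<k} x^l/l! is positive on (0, ∞), K < 1 on (0,
1); K' is a positive factor times a Taylor remainder of e^L, so K increases; and N(x) ~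
x^{k+1}/(k+1)! at 0. Hence 1 - K(p) ~ (1-p)^k/(k+1)! as p ↑ 1 (`tendsto_one_sub_upperKernel_div`),
which is (b). For the density, F carries the law f dx to the uniform law
(`IsPDFOf.map_densityMeasure`), so the integral of f · K'(F) up to x is ∫_0^{F(x)} K' = K(F(x)),
with no chain rule for F.

For (c)-(e), the hypothesis says s(1 - F(a_s z + b_s)) → τ(z) = -ln G(z) for real s → ∞, with a, b
sampled at ⌊s⌋. Inverting this for V(s) = F⁻(1 - 1/s) gives the limits of (V(2s) - V(s))/a_s and of
a_{2s}/a_s. If the latter limit q is 2^{1/α} > 1, comparison along doublings gives V ~ a (Fréchet,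
`tendsto_div_of_doubling_expanding`); if q = 2^{-1/α} < 1, it gives r(F) < ∞ and r(F) - V ~ a
(Weibull, `tendsto_sub_div_of_doubling_contracting`). In the Gumbel case the same comparison is
applied to ∫_0^{V(s)} (1-F) against a_s/s, where q = 1/2: the tail is integrable and the mean
residual life at t is asymptotic to a_s at s = 1/(1 - F(t)).

So F satisfies its tail limit with the standard constants, and `tendsto_tail_upperU` raises that
limit to the power k. In (c) and (d) the level t is chosen with (k+1)! t^k = n; in (e) the factor
(k+1)! t^k cancels in a ratio. -/

/-! ### Truncated exponential sums and the numerator N. -/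

/-- The partial sum `∑_{l < n} x^l / l!` of the exponential series. -/
noncomputable def expPartial (n : ℕ) (x : ℝ) : ℝ :=
  ∑ l ∈ Finset.range n, x ^ l / (l.factorial : ℝ)

/-- The weighted sum `∑_{l < k} (k - l) x^l / l!`. -/
noncomputable def expWeighted (k : ℕ) (x : ℝ) : ℝ :=
  ∑ l ∈ Finset.range k, ((k : ℝ) - l) * (x ^ l / (l.factorial : ℝ))

theorem expPartial_succ (n : ℕ) (x : ℝ) :
    expPartial (n + 1) x = expPartial n x + x ^ n / (n.factorial : ℝ) := by
  simp [expPartial, Finset.sum_range_succ]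

theorem hasDerivAt_expPartial_succ (n : ℕ) (x : ℝ) :
    HasDerivAt (expPartial (n + 1)) (expPartial n x) x := by
  induction n with
  | zero =>
    have : expPartial 1 = fun _ => (1 : ℝ) := by
      funext y; simp [expPartial]
    rw [zero_add, this]
    simpa [expPartial] using hasDerivAt_const x (1 : ℝ)
  | succ n ih =>
    have h : expPartial (n + 1 + 1)
        = fun y => expPartial (n + 1) y + y ^ (n + 1) / ((n + 1).factorial : ℝ) := by
      funext y; exact expPartial_succ _ _
    rw [h, expPartial_succ n x]
    refine ih.add ?_
    refine ((hasDerivAt_pow (n + 1) x).div_const _).congr_deriv ?_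
    have : (n.factorial : ℝ) ≠ 0 := by positivity
    rw [Nat.factorial_succ]
    push_cast
    field_simp

theorem expWeighted_succ (k : ℕ) (x : ℝ) :
    expWeighted (k + 1) x = expWeighted k x + expPartial (k + 1) x := by
  rw [expPartial_succ]
  simp only [expWeighted, expPartial]
  rw [Finset.sum_range_succ, ← add_assoc, ← Finset.sum_add_distrib]
  push_cast
  congr 1
  · exact Finset.sum_congr rfl fun l _ => by ring
  · ring

theorem hasDerivAt_expWeighted (k : ℕ) (x : ℝ) :
    HasDerivAt (expWeighted k) (expWeighted k x - expPartial k x) x := by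
  induction k with
  | zero =>
    have : expWeighted 0 = fun _ => (0 : ℝ) := by funext y; simp [expWeighted]
    rw [this]
    simpa [expPartial] using hasDerivAt_const x (0 : ℝ)
  | succ k ih =>
    have h : expWeighted (k + 1) = fun y => expWeighted k y + expPartial (k + 1) y := by
      funext y; exact expWeighted_succ _ _
    rw [h]
    refine (ih.add (hasDerivAt_expPartial_succ k x)).congr_deriv ?_
    ring

/-- Coefficients of x^l/l! add up as (k - l) + l = k. This removes the weighted sum from the
derivative of the kernel. -/
theorem expWeighted_add_mul_expPartial (k : ℕ) (x : ℝ) :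
    expWeighted k x + x * expPartial k x = k * expPartial (k + 1) x := by
  induction k with
  | zero => simp [expWeighted, expPartial]
  | succ k ih =>
    rw [expWeighted_succ, expPartial_succ (k + 1), Nat.factorial_succ]
    have h1 : x * expPartial (k + 1) x = x * expPartial k x + x * (x ^ k / (k.factorial : ℝ)) := by
      rw [expPartial_succ]; ring
    have : (k.factorial : ℝ) ≠ 0 := by positivity
    rw [h1]
    push_cast
    have h2 : ((k : ℝ) + 1) * (x ^ (k + 1) / (((k : ℝ) + 1) * (k.factorial : ℝ)))
        = x * (x ^ k / (k.factorial : ℝ)) := by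
      field_simp
      ring
    rw [mul_add, h2]
    linarith

theorem expPartial_lt_exp (n : ℕ) {x : ℝ} (hx : 0 < x) : expPartial n x < Real.exp x := by
  have h := Real.sum_le_exp_of_nonneg hx.le (n + 1)
  have h2 : expPartial (n + 1) x ≤ Real.exp x := h
  rw [expPartial_succ] at h2
  have : 0 < x ^ n / (n.factorial : ℝ) := by positivity
  linarith

/-- The function `x - k + e^{-x} ∑_{l < k} (k - l) x^l / l!`, which is `x (1 - U_k)` at
`x = -ln F`. -/
noncomputable def tailNumerator (k : ℕ) (x : ℝ) : ℝ :=
  x - k + Real.exp (-x) * expWeighted k x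

/-- As W' = W - E for the weighted sum W and partial sum E, the two terms e^{-x} W of the product
rule cancel. -/
theorem hasDerivAt_tailNumerator (k : ℕ) (x : ℝ) :
    HasDerivAt (tailNumerator k) (1 - Real.exp (-x) * expPartial k x) x := by
  have h1 : HasDerivAt (fun y : ℝ => Real.exp (-y)) (Real.exp (-x) * (-1)) x :=
    (hasDerivAt_neg x).exp
  refine (((hasDerivAt_id x).sub_const (k : ℝ)).add
    (h1.mul (hasDerivAt_expWeighted k x))).congr_deriv ?_
  ring

theorem tailNumerator_zero (k : ℕ) : tailNumerator k 0 = 0 := by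
  cases k with
  | zero => simp [tailNumerator, expWeighted]
  | succ k => simp [tailNumerator, expWeighted, Finset.sum_range_succ']

theorem exp_neg_mul_expPartial_lt_one (k : ℕ) {x : ℝ} (hx : 0 < x) :
    Real.exp (-x) * expPartial k x < 1 := by
  have h := expPartial_lt_exp k hx
  have := mul_lt_mul_of_pos_left h (Real.exp_pos (-x))
  rwa [← Real.exp_add, neg_add_cancel, Real.exp_zero] at this

theorem tailNumerator_pos (k : ℕ) {x : ℝ} (hx : 0 < x) : 0 < tailNumerator k x := by
  have hmono : StrictMonoOn (tailNumerator k) (Set.Ici 0) := by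
    refine strictMonoOn_of_deriv_pos (convex_Ici 0)
      (fun y _ => (hasDerivAt_tailNumerator k y).continuousAt.continuousWithinAt) ?_
    intro y hy
    rw [interior_Ici] at hy
    rw [(hasDerivAt_tailNumerator k y).deriv]
    linarith [exp_neg_mul_expPartial_lt_one k hy]
  have := hmono (Set.mem_Ici.2 le_rfl) (Set.mem_Ici.2 hx.le) hx
  rwa [tailNumerator_zero] at this

theorem tendsto_exp_sub_expPartial_div_pow (k : ℕ) :
    Tendsto (fun x => (Real.exp x - expPartial k x) / x ^ k) (𝓝[>] 0)
      (𝓝 (1 / (k.factorial : ℝ))) := by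
  have h := (Real.exp_sub_sum_range_succ_isLittleO_pow k).tendsto_div_nhds_zero
  have h' := (h.mono_left (nhdsWithin_le_nhds (s := Set.Ioi 0))).add_const (1 / (k.factorial : ℝ))
  rw [zero_add] at h'
  refine h'.congr' ?_
  filter_upwards [self_mem_nhdsWithin] with x hx
  have hx0 : x ^ k ≠ 0 := pow_ne_zero _ (ne_of_gt hx)
  have : (∑ i ∈ Finset.range (k + 1), x ^ i / (i.factorial : ℝ))
      = expPartial k x + x ^ k / (k.factorial : ℝ) := expPartial_succ k x
  rw [this]
  have : (k.factorial : ℝ) ≠ 0 := by positivity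
  field_simp
  ring

/-- One use of L'Hôpital: the quotient of derivatives is (e^x - E(x))/x^k · e^{-x}/(k+1), with E the
partial sum of k terms. -/
theorem tendsto_tailNumerator_div_pow (k : ℕ) :
    Tendsto (fun x => tailNumerator k x / x ^ (k + 1)) (𝓝[>] 0)
      (𝓝 (1 / ((k + 1).factorial : ℝ))) := by
  refine HasDerivAt.lhopital_zero_nhdsGT (Eventually.of_forall (hasDerivAt_tailNumerator k))
    (Eventually.of_forall fun x => hasDerivAt_pow (k + 1) x) ?_ ?_ ?_ ?_
  · filter_upwards [self_mem_nhdsWithin] with x hx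
    have : (0 : ℝ) < x := hx
    positivity
  · have := (hasDerivAt_tailNumerator k 0).continuousAt.tendsto
    rw [tailNumerator_zero] at this
    exact this.mono_left nhdsWithin_le_nhds
  · have := (continuous_pow (M := ℝ) (k + 1)).tendsto 0
    simp only [ne_eq, Nat.add_eq_zero_iff, one_ne_zero, and_false, not_false_eq_true,
      zero_pow] at this
    exact this.mono_left nhdsWithin_le_nhds
  · have h1 := tendsto_exp_sub_expPartial_div_pow k
    have h2 : Tendsto (fun x : ℝ => Real.exp (-x) / ((k : ℝ) + 1)) (𝓝[>] 0)
        (𝓝 (1 / ((k : ℝ) + 1))) := by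
      have : Continuous fun x : ℝ => Real.exp (-x) / ((k : ℝ) + 1) := by fun_prop
      have := this.tendsto 0
      simp only [neg_zero, Real.exp_zero] at this
      exact this.mono_left nhdsWithin_le_nhds
    have h3 := h1.mul h2
    have e : 1 / (k.factorial : ℝ) * (1 / ((k : ℝ) + 1)) = 1 / ((k + 1).factorial : ℝ) := by
      rw [Nat.factorial_succ]; push_cast; field_simp
    rw [e] at h3
    refine h3.congr' ?_
    filter_upwards [self_mem_nhdsWithin] with x hx
    have hx0 : x ≠ 0 := ne_of_gt hx
    have he : Real.exp (-x) * Real.exp x = 1 := by rw [← Real.exp_add]; simp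
    have hk : ((k : ℝ) + 1) ≠ 0 := by positivity
    push_cast
    rw [div_mul_div_comm]
    rw [← he]
    field_simp

/-! ### The kernel K on [0, 1]. -/

/-- The distribution function on `[0, 1]` with `U_k = upperKernel k ∘ F`. -/
noncomputable def upperKernel (k : ℕ) (p : ℝ) : ℝ :=
  if p ≤ 0 then 0
  else if 1 ≤ p then 1
  else (k : ℝ) * ((1 - p) / (-Real.log p))
    - p * ∑ l ∈ Finset.Icc 1 (k - 1),
        ((k : ℝ) - (l : ℝ)) * ((-Real.log p) ^ (l - 1) / (l.factorial : ℝ))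

theorem upperU_eq (F : ℝ → ℝ) (k : ℕ) (x : ℝ) : upperU F k x = upperKernel k (F x) := rfl

theorem upperKernel_of_mem {k : ℕ} (hk : 1 ≤ k) {p : ℝ} (h0 : 0 < p) (h1 : p < 1) :
    upperKernel k p = 1 - tailNumerator k (-Real.log p) / (-Real.log p) := by
  rw [upperKernel, if_neg h0.not_ge, if_neg h1.not_ge, tailNumerator, neg_neg, Real.exp_log h0]
  have hL : 0 < -Real.log p := neg_pos.2 (Real.log_neg h0 h1)
  set L := -Real.log p
  obtain ⟨m, rfl⟩ : ∃ m, k = m + 1 := ⟨k - 1, by omega⟩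
  -- Splitting off the constant term k leaves a multiple of L, which is the source of the exponents
  -- l - 1.
  have hs : expWeighted (m + 1) L = ((m + 1 : ℕ) : ℝ) + L * ∑ l ∈ Finset.Icc 1 (m + 1 - 1),
      (((m + 1 : ℕ) : ℝ) - (l : ℝ)) * (L ^ (l - 1) / (l.factorial : ℝ)) := by
    rw [expWeighted, Finset.sum_range_succ', add_comm, Finset.mul_sum]
    congr 1
    · simp
    · rw [Nat.add_sub_cancel, ← Finset.Ico_succ_right_eq_Icc, Finset.sum_Ico_eq_sum_range]
      refine Finset.sum_congr (by simp) fun l _ => ?_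
      rw [add_comm 1 l, Nat.add_sub_cancel]
      ring
  rw [hs]
  field_simp
  ring

theorem upperKernel_of_nonpos (k : ℕ) {p : ℝ} (h : p ≤ 0) : upperKernel k p = 0 := by
  rw [upperKernel, if_pos h]

theorem upperKernel_of_one_le (k : ℕ) {p : ℝ} (h : 1 ≤ p) : upperKernel k p = 1 := by
  rw [upperKernel, if_neg (by linarith), if_pos h]

theorem upperKernel_lt_one {k : ℕ} (hk : 1 ≤ k) {p : ℝ} (h1 : p < 1) : upperKernel k p < 1 := by
  rcases le_or_gt p 0 with h0 | h0
  · rw [upperKernel_of_nonpos k h0]; exact one_pos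
  · rw [upperKernel_of_mem hk h0 h1]
    have hL : 0 < -Real.log p := neg_pos.2 (Real.log_neg h0 h1)
    have := div_pos (tailNumerator_pos k hL) hL
    linarith

theorem upperKernel_lt_one_iff {k : ℕ} (hk : 1 ≤ k) {p : ℝ} : upperKernel k p < 1 ↔ p < 1 := by
  refine ⟨fun h => ?_, upperKernel_lt_one hk⟩
  by_contra hp
  rw [upperKernel_of_one_le k (not_lt.1 hp)] at h
  exact lt_irrefl _ h

/-- The derivative of `upperKernel` on `(0, 1)`, extended by zero. -/
noncomputable def upperKernelDeriv (k : ℕ) (p : ℝ) : ℝ :=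
  if 0 < p ∧ p < 1 then
    (k : ℝ) / (-Real.log p) ^ 2 * (1 / p - expPartial (k + 1) (-Real.log p))
  else 0

theorem upperKernelDeriv_nonneg (k : ℕ) (p : ℝ) : 0 ≤ upperKernelDeriv k p := by
  unfold upperKernelDeriv
  split_ifs with h
  · have hL : 0 < -Real.log p := neg_pos.2 (Real.log_neg h.1 h.2)
    have := expPartial_lt_exp (k + 1) hL
    rw [Real.exp_neg, Real.exp_log h.1] at this
    rw [one_div]
    have h2 : 0 ≤ p⁻¹ - expPartial (k + 1) (-Real.log p) := by linarith
    positivity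
  · exact le_rfl

theorem hasDerivAt_upperKernel {k : ℕ} (hk : 1 ≤ k) {p : ℝ} (h0 : 0 < p) (h1 : p < 1) :
    HasDerivAt (upperKernel k) (upperKernelDeriv k p) p := by
  have hL : 0 < -Real.log p := neg_pos.2 (Real.log_neg h0 h1)
  have hlog : HasDerivAt (fun q => -Real.log q) (-p⁻¹) p := (Real.hasDerivAt_log h0.ne').neg
  have hN := (hasDerivAt_tailNumerator k (-Real.log p)).comp p hlog
  have hQ := (hN.div hlog hL.ne').const_sub 1
  rw [upperKernelDeriv, if_pos ⟨h0, h1⟩]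
  have heq : (fun q => 1 - ((tailNumerator k ∘ fun q => -Real.log q) / fun q => -Real.log q) q)
      =ᶠ[𝓝 p] upperKernel k := by
    filter_upwards [Ioo_mem_nhds h0 h1] with q hq
    rw [upperKernel_of_mem hk hq.1 hq.2]; rfl
  refine (hQ.congr_of_eventuallyEq heq.symm).congr_deriv ?_
  have hW := expWeighted_add_mul_expPartial k (-Real.log p)
  simp only [Function.comp_apply, tailNumerator, neg_neg, Real.exp_log h0]
  have hW' : expWeighted k (-Real.log p)
      = k * expPartial (k + 1) (-Real.log p) - (-Real.log p) * expPartial k (-Real.log p) := by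
    linarith
  rw [hW']
  set L := -Real.log p
  field_simp
  ring

theorem expWeighted_nonneg (k : ℕ) {x : ℝ} (hx : 0 ≤ x) : 0 ≤ expWeighted k x := by
  refine Finset.sum_nonneg fun l hl => ?_
  have : (l : ℝ) < k := by exact_mod_cast Finset.mem_range.1 hl
  have : 0 ≤ (k : ℝ) - l := by linarith
  positivity

theorem expWeighted_le (k : ℕ) {x : ℝ} (hx : 0 ≤ x) : expWeighted k x ≤ k * expPartial k x := by
  rw [expWeighted, expPartial, Finset.mul_sum]
  refine Finset.sum_le_sum fun l _ => ?_
  have : 0 ≤ x ^ l / (l.factorial : ℝ) := by positivity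
  have : 0 ≤ (l : ℝ) := by positivity
  nlinarith

/-- Both bounds come from K = (k - e^{-L} W)/L and 0 ≤ W ≤ k e^L, with W the weighted sum. The upper
one yields continuity at p = 0, where L → ∞. -/
theorem upperKernel_mem_bounds {k : ℕ} (hk : 1 ≤ k) {p : ℝ} (h0 : 0 < p) (h1 : p < 1) :
    0 ≤ upperKernel k p ∧ upperKernel k p ≤ k / (-Real.log p) := by
  have hL : 0 < -Real.log p := neg_pos.2 (Real.log_neg h0 h1)
  rw [upperKernel_of_mem hk h0 h1, tailNumerator]
  set L := -Real.log p
  have hw0 := expWeighted_nonneg k hL.le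
  have hw1 := expWeighted_le k hL.le
  have he := exp_neg_mul_expPartial_lt_one k hL
  have hpos := Real.exp_pos (-L)
  have e : 1 - (L - k + Real.exp (-L) * expWeighted k L) / L
      = (k - Real.exp (-L) * expWeighted k L) / L := by field_simp; ring
  rw [e]
  have h2 : Real.exp (-L) * expWeighted k L ≤ k := by
    calc _ ≤ Real.exp (-L) * (k * expPartial k L) := by gcongr
      _ = k * (Real.exp (-L) * expPartial k L) := by ring
      _ ≤ k * 1 := by gcongr
      _ = k := mul_one _
  constructor
  · exact div_nonneg (by linarith) hL.le
  · gcongr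
    have := mul_nonneg hpos.le hw0
    linarith

theorem tendsto_neg_log_nhdsLT_one : Tendsto (fun p => -Real.log p) (𝓝[<] 1) (𝓝[>] 0) := by
  refine tendsto_nhdsWithin_iff.2 ⟨?_, ?_⟩
  · have : Tendsto (fun p => -Real.log p) (𝓝 1) (𝓝 (-Real.log 1)) :=
      (Real.continuousAt_log one_ne_zero).neg.tendsto
    rw [Real.log_one, neg_zero] at this
    exact this.mono_left nhdsWithin_le_nhds
  · filter_upwards [Ioo_mem_nhdsLT (zero_lt_one (α := ℝ))] with p hp
    exact neg_pos.2 (Real.log_neg hp.1 hp.2)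

theorem tendsto_neg_log_div_one_sub :
    Tendsto (fun p => -Real.log p / (1 - p)) (𝓝[<] 1) (𝓝 1) := by
  have h := (hasDerivAt_iff_tendsto_slope.1 (Real.hasDerivAt_log one_ne_zero))
  rw [inv_one] at h
  refine (h.mono_left (nhdsWithin_mono _ fun x hx => ne_of_lt hx)).congr fun p => ?_
  rw [slope_def_field, Real.log_one, sub_zero, ← neg_sub 1 p, div_neg, neg_div]

/-- The ratio factors as N(L)/L^{k+1} · (L/(1-p))^k, and L ~ 1 - p at p = 1. -/
theorem tendsto_one_sub_upperKernel_div {k : ℕ} (hk : 1 ≤ k) :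
    Tendsto (fun p => (1 - upperKernel k p) / (1 - p) ^ k) (𝓝[<] 1)
      (𝓝 (1 / ((k + 1).factorial : ℝ))) := by
  have h := ((tendsto_tailNumerator_div_pow k).comp tendsto_neg_log_nhdsLT_one).mul
    (tendsto_neg_log_div_one_sub.pow k)
  rw [one_pow, mul_one] at h
  refine h.congr' ?_
  filter_upwards [Ioo_mem_nhdsLT (zero_lt_one (α := ℝ))] with p hp
  have hL : 0 < -Real.log p := neg_pos.2 (Real.log_neg hp.1 hp.2)
  have hq : 0 < 1 - p := sub_pos.2 hp.2
  rw [upperKernel_of_mem hk hp.1 hp.2]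
  simp only [Function.comp_apply]
  set L := -Real.log p
  rw [div_pow, sub_sub_cancel]
  field_simp
  ring

theorem upperKernel_mem_Icc {k : ℕ} (hk : 1 ≤ k) (p : ℝ) :
    0 ≤ upperKernel k p ∧ upperKernel k p ≤ 1 := by
  rcases le_or_gt p 0 with h0 | h0
  · rw [upperKernel_of_nonpos k h0]; norm_num
  rcases lt_or_ge p 1 with h1 | h1
  · exact ⟨(upperKernel_mem_bounds hk h0 h1).1, (upperKernel_lt_one hk h1).le⟩
  · rw [upperKernel_of_one_le k h1]; norm_num

theorem continuous_upperKernel {k : ℕ} (hk : 1 ≤ k) : Continuous (upperKernel k) := by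
  rw [continuous_iff_continuousAt]
  intro p
  rcases lt_trichotomy p 0 with h0 | rfl | h0
  · refine continuousAt_const.congr (f := fun _ => (0 : ℝ)) ?_
    filter_upwards [Iio_mem_nhds h0] with q hq
    exact (upperKernel_of_nonpos k (le_of_lt hq)).symm
  · rw [ContinuousAt, upperKernel_of_nonpos k le_rfl]
    nth_rewrite 1 [← nhdsLE_sup_nhdsGT]
    refine Tendsto.sup ?_ ?_
    · refine tendsto_const_nhds.congr' ?_
      filter_upwards [self_mem_nhdsWithin] with q hq
      exact (upperKernel_of_nonpos k hq).symm
    · have hlim : Tendsto (fun q => (k : ℝ) / (-Real.log q)) (𝓝[>] 0) (𝓝 0) := by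
        have hn : Tendsto (fun q => -Real.log q) (𝓝[>] 0) atTop :=
          tendsto_neg_atBot_atTop.comp Real.tendsto_log_nhdsGT_zero
        exact hn.const_div_atTop _
      refine tendsto_of_tendsto_of_tendsto_of_le_of_le' tendsto_const_nhds hlim ?_ ?_ <;>
        filter_upwards [Ioo_mem_nhdsGT (zero_lt_one (α := ℝ))] with q hq
      · exact (upperKernel_mem_bounds hk hq.1 hq.2).1
      · exact (upperKernel_mem_bounds hk hq.1 hq.2).2
  rcases lt_trichotomy p 1 with h1 | rfl | h1
  · exact (hasDerivAt_upperKernel hk h0 h1).continuousAt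
  · rw [ContinuousAt, upperKernel_of_one_le k le_rfl]
    nth_rewrite 1 [← nhdsLT_sup_nhdsGE]
    refine Tendsto.sup ?_ ?_
    · have hp : Tendsto (fun q : ℝ => (1 - q) ^ k) (𝓝[<] 1) (𝓝 0) := by
        have : Continuous fun q : ℝ => (1 - q) ^ k := by fun_prop
        have := this.tendsto 1
        rw [sub_self, zero_pow (by omega)] at this
        exact this.mono_left nhdsWithin_le_nhds
      -- Continuity at 1 follows from the tail asymptotics: 1 - K is a bounded ratio times (1-p)^k →
      -- 0.
      have h := ((tendsto_one_sub_upperKernel_div hk).mul hp).const_sub 1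
      rw [mul_zero, sub_zero] at h
      refine h.congr' ?_
      filter_upwards [self_mem_nhdsWithin] with q hq
      have : (1 - q) ^ k ≠ 0 := pow_ne_zero _ (sub_pos.2 hq).ne'
      rw [div_mul_cancel₀ _ this, sub_sub_cancel]
    · refine tendsto_const_nhds.congr' ?_
      filter_upwards [self_mem_nhdsWithin] with q hq
      exact (upperKernel_of_one_le k hq).symm
  · refine continuousAt_const.congr (f := fun _ => (1 : ℝ)) ?_
    filter_upwards [Ioi_mem_nhds h1] with q hq
    exact (upperKernel_of_one_le k (le_of_lt hq)).symm

theorem monotone_upperKernel {k : ℕ} (hk : 1 ≤ k) : Monotone (upperKernel k) := by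
  have hmono : MonotoneOn (upperKernel k) (Set.Icc 0 1) := by
    refine monotoneOn_of_deriv_nonneg (convex_Icc 0 1) (continuous_upperKernel hk).continuousOn ?_ ?_
    · rw [interior_Icc]
      exact fun p hp => (hasDerivAt_upperKernel hk hp.1 hp.2).differentiableAt.differentiableWithinAt
    · rw [interior_Icc]
      intro p hp
      rw [(hasDerivAt_upperKernel hk hp.1 hp.2).deriv]
      exact upperKernelDeriv_nonneg k p
  intro p q hpq
  rcases le_or_gt p 0 with h0 | h0
  · rw [upperKernel_of_nonpos k h0]; exact (upperKernel_mem_Icc hk q).1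
  rcases lt_or_ge q 1 with h1 | h1
  · exact hmono ⟨h0.le, by linarith⟩ ⟨by linarith, h1.le⟩ hpq
  · rw [upperKernel_of_one_le k h1]; exact (upperKernel_mem_Icc hk p).2

/-! ### Continuous dfs and their composition with K. -/

theorem IsDF.nonneg {F : ℝ → ℝ} (hF : IsDF F) (x : ℝ) : 0 ≤ F x :=
  hF.mono.le_of_tendsto hF.tendsto_atBot x

theorem IsDF.le_one {F : ℝ → ℝ} (hF : IsDF F) (x : ℝ) : F x ≤ 1 :=
  hF.mono.ge_of_tendsto hF.tendsto_atTop x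

theorem IsPDFOf.continuous {F f : ℝ → ℝ} (hf : IsPDFOf f F) : Continuous F := by
  have h : F = fun x => (∫ t in Set.Iic (0 : ℝ), f t) + ∫ t in (0 : ℝ)..x, f t := by
    funext x
    rw [hf.eq_integral x, ← intervalIntegral.integral_Iic_sub_Iic
      hf.integrable.integrableOn hf.integrable.integrableOn]
    ring
  rw [h]
  exact continuous_const.add
    (intervalIntegral.continuous_primitive (fun _ _ => hf.integrable.intervalIntegrable) 0)

theorem IsDF.exists_eq {F : ℝ → ℝ} (hF : IsDF F) (hc : Continuous F) {p : ℝ} (h0 : 0 < p)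
    (h1 : p < 1) : ∃ x, F x = p := by
  obtain ⟨x, hx⟩ := (hF.tendsto_atBot.eventually (gt_mem_nhds h0)).exists
  obtain ⟨y, hy⟩ := (hF.tendsto_atTop.eventually (lt_mem_nhds h1)).exists
  exact mem_range_of_exists_le_of_exists_ge hc ⟨x, hx.le⟩ ⟨y, hy.le⟩

theorem IsDF.comp_upperKernel {F : ℝ → ℝ} (hF : IsDF F) (hc : Continuous F) {k : ℕ}
    (hk : 1 ≤ k) : IsDF (upperU F k) where
  mono := (monotone_upperKernel hk).comp hF.mono
  right_cont x := ((continuous_upperKernel hk).comp hc).continuousWithinAt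
  tendsto_atBot := by
    have := ((continuous_upperKernel hk).tendsto 0).comp hF.tendsto_atBot
    rwa [upperKernel_of_nonpos k le_rfl] at this
  tendsto_atTop := by
    have := ((continuous_upperKernel hk).tendsto 1).comp hF.tendsto_atTop
    rwa [upperKernel_of_one_le k le_rfl] at this

theorem rightExt_upperU (F : ℝ → ℝ) {k : ℕ} (hk : 1 ≤ k) :
    rightExt (upperU F k) = rightExt F := by
  simp only [rightExt, upperU_eq, upperKernel_lt_one_iff hk]

/-! ### The density u_k, by the probability integral transform. -/

/-- The law of a random variable with density `f`. -/
noncomputable def densityMeasure (f : ℝ → ℝ) : Measure ℝ :=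
  volume.withDensity fun x => ENNReal.ofReal (f x)

theorem IsPDFOf.densityMeasure_Iic {F f : ℝ → ℝ} (hf : IsPDFOf f F) (x : ℝ) :
    densityMeasure f (Set.Iic x) = ENNReal.ofReal (F x) := by
  rw [densityMeasure, withDensity_apply _ measurableSet_Iic, hf.eq_integral,
    ofReal_integral_eq_lintegral_ofReal hf.integrable.integrableOn
      (Eventually.of_forall hf.nonneg)]

theorem IsPDFOf.densityMeasure_univ {F f : ℝ → ℝ} (hF : IsDF F) (hf : IsPDFOf f F) :
    densityMeasure f Set.univ = 1 := by
  have h1 : Tendsto (fun x => densityMeasure f (Set.Iic x)) atTop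
      (𝓝 (densityMeasure f Set.univ)) := by
    have := tendsto_measure_iUnion_atTop (μ := densityMeasure f)
      (s := fun x : ℝ => Set.Iic x) (fun _ _ h => Set.Iic_subset_Iic.2 h)
    rwa [Set.iUnion_Iic] at this
  refine tendsto_nhds_unique h1 ?_
  simp_rw [hf.densityMeasure_Iic]
  rw [← ENNReal.ofReal_one]
  exact (ENNReal.continuous_ofReal.tendsto 1).comp hF.tendsto_atTop

/-- For 0 < q < 1 the set {F ≤ q} is a closed half-line whose endpoint has F = q by continuity. For
p = 0 the set may be empty, so it is squeezed by small q > 0. -/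
theorem IsPDFOf.densityMeasure_preimage_Iic {F f : ℝ → ℝ} (hF : IsDF F) (hf : IsPDFOf f F)
    {p : ℝ} (h0 : 0 ≤ p) (h1 : p < 1) :
    densityMeasure f (F ⁻¹' Set.Iic p) = ENNReal.ofReal p := by
  have hpos : ∀ q, 0 < q → q < 1 → densityMeasure f (F ⁻¹' Set.Iic q) = ENNReal.ofReal q := by
    intro q hq0 hq1
    set S := F ⁻¹' Set.Iic q
    have hcl : IsClosed S := isClosed_Iic.preimage hf.continuous
    obtain ⟨x, hx⟩ := hF.exists_eq hf.continuous hq0 hq1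
    have hxS : x ∈ S := hx.le
    have hbdd : BddAbove S := by
      obtain ⟨y, hy⟩ := (hF.tendsto_atTop.eventually (lt_mem_nhds hq1)).exists
      refine ⟨y, fun z hz => ?_⟩
      by_contra hlt
      exact absurd (hF.mono (not_le.1 hlt).le) (not_le.2 (lt_of_le_of_lt hz hy))
    have hm := hcl.csSup_mem ⟨x, hxS⟩ hbdd
    have hS : S = Set.Iic (sSup S) := by
      ext z
      refine ⟨fun hz => le_csSup hbdd hz, fun hz => ?_⟩
      exact (hF.mono hz).trans hm
    have hF' : F (sSup S) = q := le_antisymm hm (hx ▸ hF.mono (le_csSup hbdd hxS))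
    rw [hS, hf.densityMeasure_Iic, hF']
  rcases h0.eq_or_lt with rfl | h0
  · rw [ENNReal.ofReal_zero]
    have hle : ∀ q : ℝ, 0 < q → q < 1 →
        densityMeasure f (F ⁻¹' Set.Iic 0) ≤ ENNReal.ofReal q := fun q hq0 hq1 => by
      rw [← hpos q hq0 hq1]
      exact measure_mono (Set.preimage_mono (Set.Iic_subset_Iic.2 hq0.le))
    have ht : Tendsto (fun q : ℝ => ENNReal.ofReal q) (𝓝[>] 0) (𝓝 0) := by
      have := ENNReal.continuous_ofReal.tendsto 0
      rw [ENNReal.ofReal_zero] at this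
      exact this.mono_left nhdsWithin_le_nhds
    refine le_antisymm (ge_of_tendsto ht ?_) zero_le
    filter_upwards [Ioo_mem_nhdsGT (zero_lt_one (α := ℝ))] with q hq using hle q hq.1 hq.2
  · exact hpos p h0 h1

/-- The probability integral transform: `F(X)` is uniform on `[0, 1]` if `X` has continuous df
`F`. -/
theorem IsPDFOf.map_densityMeasure {F f : ℝ → ℝ} (hF : IsDF F) (hf : IsPDFOf f F) :
    Measure.map F (densityMeasure f) = volume.restrict (Set.Ioc 0 1) := by
  have hm : Measurable F := hf.continuous.measurable
  have : IsFiniteMeasure (Measure.map F (densityMeasure f)) := ⟨by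
    rw [Measure.map_apply hm MeasurableSet.univ, Set.preimage_univ,
      IsPDFOf.densityMeasure_univ hF hf]
    exact ENNReal.one_lt_top⟩
  refine Measure.ext_of_Iic _ _ fun p => ?_
  rw [Measure.map_apply hm measurableSet_Iic, Measure.restrict_apply measurableSet_Iic]
  rcases lt_or_ge p 0 with h0 | h0
  · have h1 : F ⁻¹' Set.Iic p = ∅ := by
      ext z
      simpa using lt_of_lt_of_le h0 (hF.nonneg z)
    have h2 : Set.Iic p ∩ Set.Ioc 0 1 = ∅ := by
      ext z
      simp only [Set.mem_inter_iff, Set.mem_Iic, Set.mem_Ioc, Set.mem_empty_iff_false, iff_false]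
      rintro ⟨h, h', _⟩
      linarith
    rw [h1, h2]
    simp
  rcases lt_or_ge p 1 with h1 | h1
  · have h2 : Set.Iic p ∩ Set.Ioc 0 1 = Set.Ioc 0 p := by
      ext z
      simp only [Set.mem_inter_iff, Set.mem_Iic, Set.mem_Ioc]
      constructor
      · rintro ⟨h, h', _⟩; exact ⟨h', h⟩
      · rintro ⟨h, h'⟩; exact ⟨h', h, by linarith⟩
    rw [IsPDFOf.densityMeasure_preimage_Iic hF hf h0 h1, h2, Real.volume_Ioc, sub_zero]
  · have h2 : Set.Iic p ∩ Set.Ioc 0 1 = Set.Ioc 0 1 :=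
      Set.inter_eq_right.2 fun z hz => hz.2.trans h1
    have h3 : F ⁻¹' Set.Iic p = Set.univ :=
      Set.eq_univ_of_forall fun z => (hF.le_one z).trans h1
    rw [h2, h3, IsPDFOf.densityMeasure_univ hF hf]
    simp

theorem IsPDFOf.aemeasurable_ofReal {F f : ℝ → ℝ} (hf : IsPDFOf f F) :
    AEMeasurable (fun x => ENNReal.ofReal (f x)) volume :=
  hf.integrable.aestronglyMeasurable.aemeasurable.ennreal_ofReal

theorem measurable_upperKernelDeriv (k : ℕ) : Measurable (upperKernelDeriv k) := by
  have hE : Measurable (expPartial (k + 1)) := by unfold expPartial; fun_prop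
  have hs : MeasurableSet {p : ℝ | 0 < p ∧ p < 1} := measurableSet_Ioo
  refine Measurable.ite hs ?_ measurable_const
  have := hE.comp Real.measurable_log.neg
  have h2 : Measurable fun p : ℝ => (k : ℝ) / (-Real.log p) ^ 2 * (1 / p) := by fun_prop
  simp_rw [mul_sub]
  refine h2.sub (Measurable.mul ?_ this)
  fun_prop

/-- K' is unbounded near 0, but a nonnegative derivative of a function continuous up to the
endpoints is integrable. -/
theorem integrableOn_upperKernelDeriv {k : ℕ} (hk : 1 ≤ k) {p : ℝ} (h1 : p ≤ 1) :
    IntegrableOn (upperKernelDeriv k) (Set.Ioc 0 p) :=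
  intervalIntegral.integrableOn_deriv_of_nonneg (continuous_upperKernel hk).continuousOn
    (fun _ hx => hasDerivAt_upperKernel hk hx.1 (hx.2.trans_le h1))
    fun x _ => upperKernelDeriv_nonneg k x

theorem integral_upperKernelDeriv {k : ℕ} (hk : 1 ≤ k) {p : ℝ} (h0 : 0 ≤ p) (h1 : p ≤ 1) :
    ∫ q in Set.Ioc 0 p, upperKernelDeriv k q = upperKernel k p := by
  rw [← intervalIntegral.integral_of_le h0,
    intervalIntegral.integral_eq_sub_of_hasDerivAt_of_le h0
      (continuous_upperKernel hk).continuousOn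
      (fun _ hx => hasDerivAt_upperKernel hk hx.1 (hx.2.trans_le h1))
      ((intervalIntegrable_iff_integrableOn_Ioc_of_le h0).2 (integrableOn_upperKernelDeriv hk h1)),
    upperKernel_of_nonpos k le_rfl, sub_zero]

theorem upperUDensity_eq (F f : ℝ → ℝ) (k : ℕ) (x : ℝ) :
    upperUDensity F f k x = f x * upperKernelDeriv k (F x) := by
  unfold upperUDensity upperKernelDeriv expPartial
  split_ifs
  · ring
  · ring

theorem IsPDFOf.upperUDensity {F f : ℝ → ℝ} (hF : IsDF F) (hf : IsPDFOf f F) {k : ℕ}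
    (hk : 1 ≤ k) : IsPDFOf (upperUDensity F f k) (upperU F k) := by
  have hm : Measurable F := hf.continuous.measurable
  have hlt : ∀ᵐ x : ℝ, ENNReal.ofReal (f x) < ⊤ := Eventually.of_forall fun _ => ENNReal.ofReal_lt_top
  have hsmul : ∀ g : ℝ → ℝ, (fun x => (ENNReal.ofReal (f x)).toReal • g x)
      = fun x => f x * g x := fun g => by
    funext x; rw [ENNReal.toReal_ofReal (hf.nonneg x), smul_eq_mul]
  have hd : _root_.upperUDensity F f k = fun x => f x * (upperKernelDeriv k ∘ F) x := by
    funext x; exact upperUDensity_eq F f k x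
  have hmeas := (measurable_upperKernelDeriv k).aestronglyMeasurable
    (μ := Measure.map F (densityMeasure f))
  refine ⟨fun x => ?_, ?_, fun x => ?_⟩
  · rw [upperUDensity_eq]
    exact mul_nonneg (hf.nonneg x) (upperKernelDeriv_nonneg k _)
  · rw [hd, ← hsmul, ← integrable_withDensity_iff_integrable_smul₀' hf.aemeasurable_ofReal hlt]
    change Integrable _ (densityMeasure f)
    rw [← integrable_map_measure hmeas hm.aemeasurable, IsPDFOf.map_densityMeasure hF hf]
    exact integrableOn_upperKernelDeriv hk le_rfl
  · have hae : Set.Iic x =ᵐ[densityMeasure f] F ⁻¹' Set.Iic (F x) := by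
      have hsub : Set.Iic x ⊆ F ⁻¹' Set.Iic (F x) := fun y hy => hF.mono hy
      rcases (hF.le_one x).lt_or_eq with h1 | h1
      · refine ae_eq_of_subset_of_measure_ge hsub ?_ measurableSet_Iic.nullMeasurableSet ?_
        · rw [IsPDFOf.densityMeasure_preimage_Iic hF hf (hF.nonneg x) h1, hf.densityMeasure_Iic]
        · rw [IsPDFOf.densityMeasure_preimage_Iic hF hf (hF.nonneg x) h1]
          exact ENNReal.ofReal_ne_top
      · have hu : F ⁻¹' Set.Iic (F x) = Set.univ :=
          Set.eq_univ_of_forall fun z => (hF.le_one z).trans h1.ge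
        refine ae_eq_of_subset_of_measure_ge hsub ?_ measurableSet_Iic.nullMeasurableSet ?_
        · rw [hu, IsPDFOf.densityMeasure_univ hF hf, hf.densityMeasure_Iic, h1]; simp
        · rw [hu, IsPDFOf.densityMeasure_univ hF hf]; exact ENNReal.one_ne_top
    have hint : Set.Iic (F x) ∩ Set.Ioc 0 1 = Set.Ioc 0 (F x) := by
      ext z
      simp only [Set.mem_inter_iff, Set.mem_Iic, Set.mem_Ioc]
      constructor
      · rintro ⟨h, h', _⟩; exact ⟨h', h⟩
      · rintro ⟨h, h'⟩; exact ⟨h', h, h'.trans (hF.le_one x)⟩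
    have e1 : ∫ t in Set.Iic x, _root_.upperUDensity F f k t
        = ∫ t in Set.Iic x, (upperKernelDeriv k ∘ F) t ∂(densityMeasure f) := by
      rw [densityMeasure, restrict_withDensity measurableSet_Iic,
        integral_withDensity_eq_integral_toReal_smul₀ hf.aemeasurable_ofReal.restrict
          (ae_restrict_of_ae hlt), hsmul, hd]
    rw [upperU_eq, e1, setIntegral_congr_set hae, Function.comp_def,
      ← setIntegral_map measurableSet_Iic hmeas hm.aemeasurable, IsPDFOf.map_densityMeasure hF hf,
      Measure.restrict_restrict measurableSet_Iic, hint,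
      integral_upperKernelDeriv hk (hF.nonneg x) (hF.le_one x)]

/-! ### Limits at the right extremity, and part (b). -/

theorem lt_rightExt_iff {F : ℝ → ℝ} (hF : IsDF F) (hc : Continuous F) {x : ℝ} :
    (x : EReal) < rightExt F ↔ F x < 1 := by
  rw [rightExt, lt_sSup_iff]
  constructor
  · rintro ⟨_, ⟨y, hy, rfl⟩, hxy⟩
    exact (hF.mono (EReal.coe_lt_coe_iff.1 hxy).le).trans_lt hy
  · intro hx
    have h1 : ∀ᶠ y in 𝓝[>] x, F y < 1 :=
      (hc.continuousAt.eventually (gt_mem_nhds hx)).filter_mono nhdsWithin_le_nhds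
    obtain ⟨y, hy, hxy⟩ := (h1.and self_mem_nhdsWithin).exists
    exact ⟨y, ⟨y, hy, rfl⟩, EReal.coe_lt_coe_iff.2 hxy⟩

theorem IsDF.exists_lt_one {F : ℝ → ℝ} (hF : IsDF F) : ∃ x, F x < 1 :=
  (hF.tendsto_atBot.eventually (gt_mem_nhds zero_lt_one)).exists

/-- Treats finite and infinite r(F) alike: every limit at the right extremity that depends on x
through F(x) becomes a limit p ↑ 1. -/
theorem toRightExt_eq_comap {F : ℝ → ℝ} (hF : IsDF F) (hc : Continuous F) :
    toRightExt F = comap F (𝓝[<] 1) := by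
  have hlt := fun x => lt_rightExt_iff hF hc (x := x)
  obtain ⟨x0, hx0⟩ := hF.exists_lt_one
  have hb : (𝓝[<] (rightExt F)).HasBasis (fun a => a < rightExt F)
      (fun a => Set.Ioo a (rightExt F)) :=
    nhdsLT_basis_of_exists_lt ⟨_, (hlt x0).2 hx0⟩
  have hb1 := nhdsLT_basis (1 : ℝ)
  refine le_antisymm ?_ ?_
  · rw [← map_le_iff_le_comap]
    refine (hb1.ge_iff).2 fun c hc1 => ?_
    -- The maximum with 1/2 keeps the value in (0, 1), since c may be negative.
    obtain ⟨y, hy⟩ := hF.exists_eq hc (p := max ((c + 1) / 2) (1 / 2))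
      (lt_max_of_lt_right (by norm_num)) (max_lt (by linarith) (by norm_num))
    have hy1 : F y < 1 := by rw [hy]; exact max_lt (by linarith) (by norm_num)
    have hyc : c < F y := by rw [hy]; exact lt_max_of_lt_left (by linarith)
    rw [mem_map, toRightExt, mem_comap]
    refine ⟨_, hb.mem_of_mem ((hlt y).2 hy1), fun x hx => ?_⟩
    exact ⟨hyc.trans_le (hF.mono (EReal.coe_lt_coe_iff.1 hx.1).le), (hlt x).1 hx.2⟩
  · refine (hb.comap _).ge_iff.2 fun a ha => ?_
    obtain ⟨y, hay, hy⟩ : ∃ y : ℝ, a ≤ y ∧ F y < 1 := by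
      rw [rightExt, lt_sSup_iff] at ha
      obtain ⟨_, ⟨y, hy, rfl⟩, hay⟩ := ha
      exact ⟨y, hay.le, hy⟩
    rw [mem_comap]
    refine ⟨_, hb1.mem_of_mem hy, fun x hx => ⟨?_, (hlt x).2 hx.2⟩⟩
    refine hay.trans_lt (EReal.coe_lt_coe_iff.2 ?_)
    by_contra h
    exact absurd (hF.mono (not_lt.1 h)) (not_le.2 hx.1)

theorem tendsto_toRightExt {F : ℝ → ℝ} (hF : IsDF F) (hc : Continuous F) :
    Tendsto F (toRightExt F) (𝓝[<] 1) := by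
  rw [toRightExt_eq_comap hF hc]
  exact tendsto_comap

theorem tendsto_tail_ratio_upperU {F : ℝ → ℝ} (hF : IsDF F) (hc : Continuous F) {k : ℕ}
    (hk : 1 ≤ k) : Tendsto (fun x => (1 - upperU F k x) / (1 - F x) ^ k) (toRightExt F)
      (𝓝 (1 / ((k + 1).factorial : ℝ))) :=
  (tendsto_one_sub_upperKernel_div hk).comp (tendsto_toRightExt hF hc)

theorem tailEquivalent_upperU_powTailDF {F : ℝ → ℝ} (hF : IsDF F) (hc : Continuous F) {k : ℕ}
    (hk : 1 ≤ k) : TailEquivalent (upperU F k) (powTailDF F k) := by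
  have hr : rightExt (powTailDF F k) = rightExt F := by
    have : ∀ x, powTailDF F k x < 1 ↔ F x < 1 := fun x => by
      rw [powTailDF, sub_lt_self_iff]
      constructor
      · intro h
        refine lt_of_le_of_ne (hF.le_one x) fun h1 => ?_
        rw [h1, sub_self, zero_pow (by omega)] at h
        exact lt_irrefl _ h
      · intro h
        exact pow_pos (sub_pos.2 h) k
    simp only [rightExt, this]
  refine ⟨by rw [rightExt_upperU F hk, hr], 1 / ((k + 1).factorial : ℝ), by positivity, ?_⟩
  have : toRightExt (upperU F k) = toRightExt F := by
    rw [toRightExt, toRightExt, rightExt_upperU F hk]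
  rw [this]
  refine (tendsto_tail_ratio_upperU hF hc hk).congr fun x => ?_
  rw [powTailDF, sub_sub_cancel]

/-! Convergence of families of antitone functions. -/

section Antitone

variable {ι : Type*} {l : Filter ι} {φ : ι → ℝ → ℝ} {τ : ℝ → ℝ} {J : Set ℝ}

/-- If z_i stayed above some b > z₀, then φ_i(z_i) ≤ φ_i(b), whose limit τ(b) is strictly below
τ(z₀); symmetrically on the left. Monotonicity replaces uniform convergence. -/
theorem tendsto_of_antitone_of_tendsto_apply (hφ : ∀ᶠ i in l, Antitone (φ i)) (hJ : IsOpen J)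
    (hτ : StrictAntiOn τ J) (h : ∀ z ∈ J, Tendsto (fun i => φ i z) l (𝓝 (τ z)))
    {z : ι → ℝ} {z₀ : ℝ} (hz₀ : z₀ ∈ J) (hz : Tendsto (fun i => φ i (z i)) l (𝓝 (τ z₀))) :
    Tendsto z l (𝓝 z₀) := by
  obtain ⟨ε, hε, hball⟩ := Metric.isOpen_iff.1 hJ z₀ hz₀
  have hmem : ∀ y, |y - z₀| < ε → y ∈ J := fun y hy => hball (by rwa [Metric.mem_ball, Real.dist_eq])
  refine tendsto_order.2 ⟨fun a ha => ?_, fun a ha => ?_⟩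
  · obtain ⟨b, hab, hb⟩ : ∃ b, max a (z₀ - ε) < b ∧ b < z₀ :=
      exists_between (max_lt ha (by linarith))
    have hb1 := (le_max_right _ _).trans_lt hab
    have hbJ : b ∈ J := hmem b (by rw [abs_lt]; constructor <;> linarith)
    have h1 : τ z₀ < τ b := hτ hbJ hz₀ hb
    filter_upwards [hφ, hz.eventually_lt (h b hbJ) h1] with i hi h2
    by_contra hlt
    exact absurd (hi ((not_lt.1 hlt).trans ((le_max_left _ _).trans_lt hab).le)) (not_le.2 h2)
  · obtain ⟨b, hb, hba⟩ : ∃ b, z₀ < b ∧ b < min a (z₀ + ε) :=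
      exists_between (lt_min ha (by linarith))
    have hb1 := hba.trans_le (min_le_right _ _)
    have hbJ : b ∈ J := hmem b (by rw [abs_lt]; constructor <;> linarith)
    have h1 : τ b < τ z₀ := hτ hz₀ hbJ hb
    filter_upwards [hφ, (h b hbJ).eventually_lt hz h1] with i hi h2
    by_contra hlt
    exact absurd (hi ((hba.trans_le (min_le_left _ _)).le.trans (not_lt.1 hlt))) (not_le.2 h2)

theorem tendsto_apply_of_antitone (hφ : ∀ᶠ i in l, Antitone (φ i)) (hJ : IsOpen J)
    (hτ : ContinuousOn τ J) (h : ∀ z ∈ J, Tendsto (fun i => φ i z) l (𝓝 (τ z)))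
    {w : ι → ℝ} {w₀ : ℝ} (hw₀ : w₀ ∈ J) (hw : Tendsto w l (𝓝 w₀)) :
    Tendsto (fun i => φ i (w i)) l (𝓝 (τ w₀)) := by
  have hev : ∀ P : ℝ → Prop, (∀ᶠ y in 𝓝 w₀, P y) → ∃ b c, b < w₀ ∧ w₀ < c ∧ b ∈ J ∧ c ∈ J ∧
      P b ∧ P c := by
    intro P hP
    have h1 := hP.and (hJ.mem_nhds hw₀)
    obtain ⟨b, ⟨hb1, hb2⟩, hb3⟩ := ((h1.filter_mono nhdsWithin_le_nhds).and
      (self_mem_nhdsWithin (s := Set.Iio w₀))).exists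
    obtain ⟨c, ⟨hc1, hc2⟩, hc3⟩ := ((h1.filter_mono nhdsWithin_le_nhds).and
      (self_mem_nhdsWithin (s := Set.Ioi w₀))).exists
    exact ⟨b, c, hb3, hc3, hb2, hc2, hb1, hc1⟩
  have hcont : Tendsto τ (𝓝 w₀) (𝓝 (τ w₀)) := (hτ.continuousAt (hJ.mem_nhds hw₀)).tendsto
  refine tendsto_order.2 ⟨fun a ha => ?_, fun a ha => ?_⟩
  · obtain ⟨b, c, _, hc, _, hcJ, _, hca⟩ := hev _ (hcont.eventually (lt_mem_nhds ha))
    filter_upwards [hφ, (h c hcJ).eventually (lt_mem_nhds hca), hw.eventually (gt_mem_nhds hc)]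
      with i hi h1 h2
    exact h1.trans_le (hi h2.le)
  · obtain ⟨b, c, hb, _, hbJ, _, hba, _⟩ := hev _ (hcont.eventually (gt_mem_nhds ha))
    filter_upwards [hφ, (h b hbJ).eventually (gt_mem_nhds hba), hw.eventually (lt_mem_nhds hb)]
      with i hi h1 h2
    exact (hi h2.le).trans_lt h1

end Antitone

/-! Functions controlled along `s ↦ 2 s`. -/

/-- Repeated halving brings s into the base interval, and the value can only grow on the way down.
-/
theorem le_of_doubling_le {h : ℝ → ℝ} {s₀ K : ℝ} (hs₀ : 0 < s₀)
    (hd : ∀ s, s₀ ≤ s → h (2 * s) ≤ h s) (hK : ∀ s ∈ Set.Icc s₀ (2 * s₀), h s ≤ K) :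
    ∀ s, s₀ ≤ s → h s ≤ K := by
  have key : ∀ n : ℕ, ∀ s, s₀ ≤ s → s ≤ 2 ^ (n + 1) * s₀ → h s ≤ K := by
    intro n
    induction n with
    | zero => intro s h1 h2; exact hK s ⟨h1, by simpa using h2⟩
    | succ n ih =>
      intro s h1 h2
      rcases le_or_gt s (2 * s₀) with h3 | h3
      · exact hK s ⟨h1, h3⟩
      · have h4 := hd (s / 2) (by linarith)
        rw [mul_div_cancel₀ s (two_ne_zero)] at h4
        refine h4.trans (ih (s / 2) (by linarith) ?_)
        rw [pow_succ] at h2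
        linarith
  intro s hs
  obtain ⟨n, hn⟩ := pow_unbounded_of_one_lt (s / s₀) (one_lt_two (α := ℝ))
  refine key n s hs ?_
  rw [div_lt_iff₀ hs₀] at hn
  have : (2 : ℝ) ^ n * s₀ ≤ 2 ^ (n + 1) * s₀ := by
    rw [pow_succ]
    have : 0 < (2 : ℝ) ^ n * s₀ := by positivity
    linarith
  linarith

theorem exists_bound_of_doubling {h : ℝ → ℝ}
    (hb : ∀ S, ∃ K, ∀ s ∈ Set.Icc 2 S, h s ≤ K) (hd : ∀ᶠ s in atTop, h (2 * s) ≤ h s) :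
    ∃ K, ∀ᶠ s in atTop, h s ≤ K := by
  obtain ⟨s₀, hs₀⟩ := eventually_atTop.1 (hd.and (eventually_ge_atTop 2))
  have h2 := (hs₀ s₀ le_rfl).2
  obtain ⟨K, hK⟩ := hb (2 * s₀)
  exact ⟨K, eventually_atTop.2 ⟨s₀, le_of_doubling_le (by linarith) (fun s hs => (hs₀ s hs).1)
    fun s hs => hK s ⟨h2.trans hs.1, hs.2⟩⟩⟩

/-- `|h|` is bounded on bounded subintervals of `[2, ∞)`. -/
def LocBounded (h : ℝ → ℝ) : Prop := ∀ S, ∃ K, ∀ s ∈ Set.Icc 2 S, |h s| ≤ K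

theorem LocBounded.add_mul {P κ : ℝ → ℝ} (hP : LocBounded P) (hκ : LocBounded κ) (M : ℝ) :
    LocBounded fun s => P s + M * κ s := by
  intro S
  obtain ⟨K, hK⟩ := hP S
  obtain ⟨L, hL⟩ := hκ S
  refine ⟨K + |M| * L, fun s hs => (abs_add_le _ _).trans (add_le_add (hK s hs) ?_)⟩
  rw [abs_mul]
  exact mul_le_mul_of_nonneg_left (hL s hs) (abs_nonneg M)

theorem LocBounded.neg {P : ℝ → ℝ} (hP : LocBounded P) : LocBounded fun s => -P s := fun S => by
  simpa only [abs_neg] using hP S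

theorem LocBounded.exists_bound {h : ℝ → ℝ} (hb : LocBounded h)
    (hd : ∀ᶠ s in atTop, h (2 * s) ≤ h s) : ∃ K, ∀ᶠ s in atTop, h s ≤ K :=
  exists_bound_of_doubling (fun S => (hb S).imp fun _ hK s hs => (le_abs_self _).trans (hK s hs)) hd

theorem locBounded_log : LocBounded Real.log := fun S => by
  refine ⟨Real.log S, fun s hs => ?_⟩
  have h2 : (2 : ℝ) ≤ s := hs.1
  rw [abs_of_nonneg (Real.log_nonneg (by linarith))]
  exact Real.log_le_log (by linarith) hs.2

section Doubling

variable {P κ : ℝ → ℝ} {A q : ℝ}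

/-- The sign of A + M(q - 1) decides whether P + Mκ rises or falls along doublings; the later
comparisons are all choices of M. -/
theorem tendsto_doubling_add_mul (hκ0 : ∀ᶠ s in atTop, 0 < κ s)
    (hA : Tendsto (fun s => (P (2 * s) - P s) / κ s) atTop (𝓝 A))
    (hq : Tendsto (fun s => κ (2 * s) / κ s) atTop (𝓝 q)) (M : ℝ) :
    Tendsto (fun s => ((P (2 * s) + M * κ (2 * s)) - (P s + M * κ s)) / κ s) atTop
      (𝓝 (A + M * (q - 1))) := by
  refine (hA.add ((hq.sub_const 1).const_mul M)).congr' ?_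
  filter_upwards [hκ0] with s hs
  field_simp
  ring

theorem eventually_doubling_le (hκ0 : ∀ᶠ s in atTop, 0 < κ s)
    (hA : Tendsto (fun s => (P (2 * s) - P s) / κ s) atTop (𝓝 A))
    (hq : Tendsto (fun s => κ (2 * s) / κ s) atTop (𝓝 q)) {M : ℝ} (hM : A + M * (q - 1) < 0) :
    ∀ᶠ s in atTop, P (2 * s) + M * κ (2 * s) ≤ P s + M * κ s := by
  filter_upwards [hκ0, (tendsto_doubling_add_mul hκ0 hA hq M).eventually (gt_mem_nhds hM)]
    with s hs h
  rw [div_lt_iff₀ hs, zero_mul] at h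
  linarith

theorem eventually_le_doubling (hκ0 : ∀ᶠ s in atTop, 0 < κ s)
    (hA : Tendsto (fun s => (P (2 * s) - P s) / κ s) atTop (𝓝 A))
    (hq : Tendsto (fun s => κ (2 * s) / κ s) atTop (𝓝 q)) {M : ℝ} (hM : 0 < A + M * (q - 1)) :
    ∀ᶠ s in atTop, P s + M * κ s ≤ P (2 * s) + M * κ (2 * s) := by
  filter_upwards [hκ0, (tendsto_doubling_add_mul hκ0 hA hq M).eventually (lt_mem_nhds hM)]
    with s hs h
  rw [lt_div_iff₀ hs, zero_mul] at h
  linarith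

/-- Once κ ≥ c > 0, each doubling adds at least (p - 1)c, so κ dominates a positive multiple of log
s up to a constant. -/
theorem tendsto_atTop_of_doubling (hκ0 : ∀ᶠ s in atTop, 0 < κ s) (hκb : LocBounded κ)
    (hκl : ∀ S, ∃ c, 0 < c ∧ ∀ s ∈ Set.Icc 2 S, c ≤ κ s)
    (hq : Tendsto (fun s => κ (2 * s) / κ s) atTop (𝓝 q)) (hq1 : 1 < q) :
    Tendsto κ atTop atTop := by
  obtain ⟨p, hp1, hpq⟩ := exists_between hq1
  have hd : ∀ᶠ s in atTop, p * κ s ≤ κ (2 * s) := by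
    filter_upwards [hκ0, hq.eventually (lt_mem_nhds hpq)] with s hs h
    exact ((lt_div_iff₀ hs).1 h).le
  have hlow : ∃ c, 0 < c ∧ ∀ᶠ s in atTop, c ≤ κ s := by
    obtain ⟨s₀, hs₀⟩ := eventually_atTop.1 (hd.and ((eventually_ge_atTop 2).and hκ0))
    have h2 := (hs₀ s₀ le_rfl).2.1
    obtain ⟨c, hc, hcs⟩ := hκl (2 * s₀)
    refine ⟨c, hc, eventually_atTop.2 ⟨s₀, fun s hs => ?_⟩⟩
    have := le_of_doubling_le (h := fun s => -κ s) (K := -c) (by linarith : 0 < s₀)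
      (fun s hs => ?_) (fun s hs => neg_le_neg (hcs s ⟨h2.trans hs.1, hs.2⟩)) s hs
    · linarith
    · have h1 := hs₀ s hs
      have : 0 < (p - 1) * κ s := mul_pos (by linarith) h1.2.2
      have := h1.1
      linarith
  obtain ⟨c, hc, hcs⟩ := hlow
  have hlog2 : 0 < Real.log 2 := Real.log_pos one_lt_two
  -- Chosen so that δ log s also gains exactly (p - 1)c per doubling.
  set δ := (p - 1) * c / Real.log 2
  have hδ : 0 < δ := div_pos (mul_pos (by linarith) hc) hlog2
  have hd2 : ∀ᶠ s in atTop, -(κ (2 * s) + -δ * Real.log (2 * s)) ≤ -(κ s + -δ * Real.log s) := by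
    filter_upwards [hd, hcs, eventually_gt_atTop 0] with s h1 h2 h3
    rw [Real.log_mul two_ne_zero h3.ne']
    have e : δ * Real.log 2 = (p - 1) * c := div_mul_cancel₀ _ hlog2.ne'
    have : (p - 1) * c ≤ (p - 1) * κ s := mul_le_mul_of_nonneg_left h2 (by linarith)
    linarith
  obtain ⟨K, hK⟩ := (hκb.add_mul locBounded_log (-δ)).neg.exists_bound hd2
  refine tendsto_atTop_mono' atTop (f₁ := fun s => δ * Real.log s - K) ?_ ?_
  · filter_upwards [hK] with s hs
    linarith
  · exact tendsto_atTop_add_const_right _ _ (Real.tendsto_log_atTop.const_mul_atTop hδ)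

/-- If the increments of `P` along doubling are asymptotic to `A κ`, where `κ` grows like a
positive power, then `P` is asymptotic to `A κ / (q - 1)`. -/
theorem tendsto_div_of_doubling_expanding (hκ0 : ∀ᶠ s in atTop, 0 < κ s) (hκb : LocBounded κ)
    (hPb : LocBounded P) (hκt : Tendsto κ atTop atTop)
    (hA : Tendsto (fun s => (P (2 * s) - P s) / κ s) atTop (𝓝 A))
    (hq : Tendsto (fun s => κ (2 * s) / κ s) atTop (𝓝 q)) (hq1 : 1 < q) :
    Tendsto (fun s => P s / κ s) atTop (𝓝 (A / (q - 1))) := by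
  have hq0 : 0 < q - 1 := by linarith
  have hup : ∀ K : ℝ, Tendsto (fun s => K / κ s) atTop (𝓝 0) := fun K => hκt.const_div_atTop K
  refine tendsto_order.2 ⟨fun M hM => ?_, fun M hM => ?_⟩
  · obtain ⟨N, hMN, hN⟩ := exists_between hM
    -- As N < A/(q - 1), P - Nκ eventually rises along doublings, so it is bounded below; the
    -- constant disappears after division by κ → ∞, thanks to M < N.
    have hd := eventually_le_doubling hκ0 hA hq (M := -N)
      (by rw [lt_div_iff₀ hq0] at hN; linarith)
    obtain ⟨K, hK⟩ := (hPb.add_mul hκb (-N)).neg.exists_bound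
      (hd.mono fun s hs => neg_le_neg hs)
    filter_upwards [hK, hκ0, (hup K).eventually (gt_mem_nhds (sub_pos.2 hMN))] with s h1 h2 h3
    rw [div_lt_iff₀ h2] at h3
    rw [lt_div_iff₀ h2]
    linarith
  · obtain ⟨N, hN, hMN⟩ := exists_between hM
    have hd := eventually_doubling_le hκ0 hA hq (M := -N)
      (by rw [div_lt_iff₀ hq0] at hN; linarith)
    obtain ⟨K, hK⟩ := (hPb.add_mul hκb (-N)).exists_bound hd
    filter_upwards [hK, hκ0, (hup K).eventually (gt_mem_nhds (sub_pos.2 hMN))] with s h1 h2 h3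
    rw [div_lt_iff₀ h2] at h3
    rw [div_lt_iff₀ h2]
    linarith

theorem exists_bound_of_doubling_contracting (hκ0 : ∀ᶠ s in atTop, 0 < κ s) (hκb : LocBounded κ)
    (hPb : LocBounded P)
    (hA : Tendsto (fun s => (P (2 * s) - P s) / κ s) atTop (𝓝 A))
    (hq : Tendsto (fun s => κ (2 * s) / κ s) atTop (𝓝 q)) (hq1 : q < 1) :
    ∃ K, ∀ᶠ s in atTop, P s ≤ K := by
  have hq0 : 0 < 1 - q := by linarith
  -- Large enough that A + M(q - 1) < 0, and nonnegative, so that P ≤ P + Mκ.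
  set M := |A| / (1 - q) + 1
  have hM0 : 0 ≤ M := by positivity
  have hM : A + M * (q - 1) < 0 := by
    have : |A| / (1 - q) * (1 - q) = |A| := div_mul_cancel₀ _ hq0.ne'
    have e : M * (q - 1) = -(|A| / (1 - q) * (1 - q)) - (1 - q) := by
      simp only [M]; ring
    rw [e, this]
    linarith [le_abs_self A]
  obtain ⟨K, hK⟩ := (hPb.add_mul hκb M).exists_bound (eventually_doubling_le hκ0 hA hq hM)
  refine ⟨K, ?_⟩
  filter_upwards [hK, hκ0] with s h1 h2
  have : 0 ≤ M * κ s := by positivity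
  linarith

/-- If the increments of `P` along doubling are asymptotic to `A κ`, where `κ` decays like a
negative power, then the distance of `P` to its limit is asymptotic to `A κ / (1 - q)`. -/
theorem tendsto_sub_div_of_doubling_contracting (hκ0 : ∀ᶠ s in atTop, 0 < κ s) {p : ℝ}
    (hp : Tendsto P atTop (𝓝 p)) (hA0 : A ≠ 0)
    (hA : Tendsto (fun s => (P (2 * s) - P s) / κ s) atTop (𝓝 A))
    (hq : Tendsto (fun s => κ (2 * s) / κ s) atTop (𝓝 q)) (hq1 : q < 1) :
    Tendsto (fun s => (p - P s) / κ s) atTop (𝓝 (A / (1 - q))) := by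
  have hq0 : 0 < 1 - q := by linarith
  have h2s : Tendsto (fun s : ℝ => 2 * s) atTop atTop := tendsto_id.const_mul_atTop two_pos
  have hκt : Tendsto κ atTop (𝓝 0) := by
    have h1 : Tendsto (fun s => P (2 * s) - P s) atTop (𝓝 0) := by
      simpa using (hp.comp h2s).sub hp
    have h2 := h1.div hA hA0
    rw [zero_div] at h2
    refine h2.congr' ?_
    -- κ is the increment of P divided by its ratio to κ, which has nonzero limit A; hence κ → 0.
    filter_upwards [hκ0, hA.eventually_ne hA0] with s hs h3
    have h4 : P (2 * s) - P s ≠ 0 := fun h => h3 (by rw [h, zero_div])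
    exact div_div_cancel₀ h4
  have hit : ∀ {s : ℝ}, 0 < s → Tendsto (fun n : ℕ => 2 ^ n * s) atTop atTop := fun hs =>
    (tendsto_pow_atTop_atTop_of_one_lt one_lt_two).atTop_mul_const hs
  have hlim : ∀ M : ℝ, Tendsto (fun s => P s + M * κ s) atTop (𝓝 p) := fun M => by
    simpa using hp.add (hκt.const_mul M)
  -- A function decreasing along the orbit 2^n s lies above its limit.
  have hgo : ∀ {h : ℝ → ℝ} {r : ℝ}, Tendsto h atTop (𝓝 r) →
      (∀ᶠ s in atTop, h (2 * s) ≤ h s) → ∀ᶠ s in atTop, r ≤ h s := by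
    intro h r hr hd
    obtain ⟨s₀, hs₀⟩ := eventually_atTop.1 hd
    filter_upwards [eventually_ge_atTop s₀, eventually_gt_atTop 0] with s h1 h2
    have hle : ∀ n : ℕ, s₀ ≤ 2 ^ n * s ∧ h (2 ^ n * s) ≤ h s := by
      intro n
      induction n with
      | zero => simpa using h1
      | succ n ih =>
        have e : (2 : ℝ) ^ (n + 1) * s = 2 * (2 ^ n * s) := by ring
        have : 0 < (2 : ℝ) ^ n * s := by positivity
        rw [e]
        exact ⟨by linarith, (hs₀ _ ih.1).trans ih.2⟩
    exact le_of_tendsto' (hr.comp (hit h2)) fun n => (hle n).2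
  refine tendsto_order.2 ⟨fun M hM => ?_, fun M hM => ?_⟩
  · obtain ⟨N, hMN, hN⟩ := exists_between hM
    have hd := eventually_le_doubling hκ0 hA hq (M := N)
      (by rw [lt_div_iff₀ hq0] at hN; linarith)
    filter_upwards [hgo (hlim N).neg (hd.mono fun s hs => neg_le_neg hs), hκ0] with s h1 h2
    rw [lt_div_iff₀ h2]
    have := mul_lt_mul_of_pos_right hMN h2
    linarith
  · obtain ⟨N, hN, hMN⟩ := exists_between hM
    have hd := eventually_doubling_le hκ0 hA hq (M := N)
      (by rw [div_lt_iff₀ hq0] at hN; linarith)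
    filter_upwards [hgo (hlim N) hd, hκ0] with s h1 h2
    rw [div_lt_iff₀ h2]
    have := mul_lt_mul_of_pos_right hMN h2
    linarith

end Doubling

/-! ### From limits of powers to tail limits in a real parameter. -/

theorem tendsto_nat_mul_one_sub_of_tendsto_pow {x : ℕ → ℝ} {τ : ℝ} (h0 : ∀ n, 0 ≤ x n)
    (h : Tendsto (fun n => x n ^ n) atTop (𝓝 (Real.exp (-τ)))) :
    Tendsto (fun n : ℕ => (n : ℝ) * (1 - x n)) atTop (𝓝 τ) := by
  have hpos : ∀ᶠ n in atTop, 0 < x n := by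
    filter_upwards [h.eventually (lt_mem_nhds (Real.exp_pos _)), eventually_gt_atTop 0] with n h1 h2
    refine (h0 n).lt_of_ne fun h3 => ?_
    rw [← h3, zero_pow (by omega)] at h1
    exact lt_irrefl _ h1
  have h1 : Tendsto (fun n : ℕ => (n : ℝ) * Real.log (x n)) atTop (𝓝 (-τ)) := by
    have := h.log (Real.exp_pos _).ne'
    rw [Real.log_exp] at this
    exact this.congr fun n => Real.log_pow _ _
  have h2 : Tendsto (fun n : ℕ => Real.log (x n)) atTop (𝓝 0) := by
    have := h1.div_atTop tendsto_natCast_atTop_atTop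
    refine this.congr' ?_
    filter_upwards [eventually_gt_atTop 0] with n hn
    have : (n : ℝ) ≠ 0 := by positivity
    field_simp
  have h3 : Tendsto x atTop (𝓝 1) := by
    have := (Real.continuous_exp.tendsto 0).comp h2
    rw [Real.exp_zero] at this
    refine this.congr' ?_
    filter_upwards [hpos] with n hn using Real.exp_log hn
  have h4 := (h1.mul h3).neg
  rw [mul_one, neg_neg] at h4
  have h5 := h1.neg
  rw [neg_neg] at h5
  -- The bounds 1 - 1/x ≤ log x ≤ x - 1 place n(1 - x) between -n x log x and -n log x.
  refine tendsto_of_tendsto_of_tendsto_of_le_of_le' h4 h5 ?_ ?_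
  · filter_upwards [hpos] with n hn
    have := Real.one_sub_inv_le_log_of_pos hn
    have h6 : x n - 1 ≤ Real.log (x n) * x n := by
      have := mul_le_mul_of_nonneg_right this hn.le
      rwa [sub_mul, one_mul, inv_mul_cancel₀ hn.ne'] at this
    have := mul_le_mul_of_nonneg_left h6 (Nat.cast_nonneg (α := ℝ) n)
    linarith
  · filter_upwards [hpos] with n hn
    have := Real.log_le_sub_one_of_pos hn
    have := mul_le_mul_of_nonneg_left this (Nat.cast_nonneg (α := ℝ) n)
    linarith

theorem tendsto_pow_of_tendsto_nat_mul_one_sub {x : ℕ → ℝ} {τ : ℝ}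
    (h : Tendsto (fun n : ℕ => (n : ℝ) * (1 - x n)) atTop (𝓝 τ)) :
    Tendsto (fun n => x n ^ n) atTop (𝓝 (Real.exp (-τ))) := by
  have := Real.tendsto_one_add_pow_exp_of_tendsto (g := fun n => x n - 1) (t := -τ)
    (h.neg.congr fun n => by ring)
  exact this.congr fun n => by rw [add_sub_cancel]

/-- Since s/⌊s⌋ → 1, the integer index can be a real one, which later permits doubling and the
choice s = 1/(1 - F(t)). -/
theorem MaxConverges.tendsto_floor {F G : ℝ → ℝ} (hF : IsDF F) {a b : ℕ → ℝ}
    (h : MaxConverges F G a b) {z τ : ℝ} (hz : ContinuousAt G z) (hG : G z = Real.exp (-τ)) :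
    Tendsto (fun s : ℝ => s * (1 - F (a ⌊s⌋₊ * z + b ⌊s⌋₊))) atTop (𝓝 τ) := by
  have h1 := h z hz
  rw [hG] at h1
  have h2 := (tendsto_nat_mul_one_sub_of_tendsto_pow (fun n => hF.nonneg _) h1).comp
    (tendsto_nat_floor_atTop (α := ℝ))
  have h3 := (tendsto_nat_floor_div_atTop (R := ℝ)).inv₀ one_ne_zero
  have h4 := h3.mul h2
  rw [inv_one, one_mul] at h4
  refine h4.congr' ?_
  filter_upwards [eventually_ge_atTop 1] with s hs
  have : (0 : ℝ) < ⌊s⌋₊ := by exact_mod_cast Nat.floor_pos.2 hs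
  simp only [Function.comp_apply]
  field_simp

theorem locBounded_comp_floor (a : ℕ → ℝ) : LocBounded fun s => a ⌊s⌋₊ := fun S => by
  obtain ⟨K, hK⟩ := ((Set.finite_Iic ⌊S⌋₊).image fun n => |a n|).bddAbove
  exact ⟨K, fun s hs => hK ⟨_, Nat.floor_le_floor hs.2, rfl⟩⟩

theorem exists_pos_le_comp_floor {a : ℕ → ℝ} (ha : ∀ n, 0 < a n) (S : ℝ) :
    ∃ c, 0 < c ∧ ∀ s ∈ Set.Icc 2 S, c ≤ a ⌊s⌋₊ := by
  obtain ⟨n, _, hn⟩ := (Set.finite_Iic ⌊S⌋₊).exists_minimalFor a _ ⟨0, Nat.zero_le _⟩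
  refine ⟨a n, ha n, fun s hs => ?_⟩
  rcases le_total (a n) (a ⌊s⌋₊) with h | h
  · exact h
  · exact hn (Nat.floor_le_floor hs.2) h

/-- `1 - F` regularly rescaled: `s (1 - F (α_s z + β_s)) → τ z` for `z ∈ J`, with `J` open, `τ`
continuous and strictly decreasing on `J`. -/
structure TailScaling (F α β τ : ℝ → ℝ) (J : Set ℝ) : Prop where
  pos : ∀ s, 0 < α s
  isOpen : IsOpen J
  anti : StrictAntiOn τ J
  cont : ContinuousOn τ J
  tendsto : ∀ z ∈ J, Tendsto (fun s => s * (1 - F (α s * z + β s))) atTop (𝓝 (τ z))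

section Scaling

variable {F α β τ : ℝ → ℝ} {J : Set ℝ} {ι : Type*} {l : Filter ι}

theorem TailScaling.antitone (hF : IsDF F) (h : TailScaling F α β τ J) {s : ℝ} (hs : 0 ≤ s) :
    Antitone fun z => s * (1 - F (α s * z + β s)) := fun z w hzw => by
  have h1 : α s * z + β s ≤ α s * w + β s := by
    have := mul_le_mul_of_nonneg_left hzw (h.pos s).le
    linarith
  exact mul_le_mul_of_nonneg_left (sub_le_sub_left (hF.mono h1) 1) hs

/-- With `TailScaling.tendsto_tail`, this translates both ways between limits of rescaled tails and
limits of normalized arguments. -/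
theorem TailScaling.tendsto_arg (hF : IsDF F) (h : TailScaling F α β τ J) {σ y : ι → ℝ} {z₀ : ℝ}
    (hσ : Tendsto σ l atTop) (hz₀ : z₀ ∈ J)
    (hy : Tendsto (fun i => σ i * (1 - F (y i))) l (𝓝 (τ z₀))) :
    Tendsto (fun i => (y i - β (σ i)) / α (σ i)) l (𝓝 z₀) := by
  refine tendsto_of_antitone_of_tendsto_apply
    (φ := fun i z => σ i * (1 - F (α (σ i) * z + β (σ i))))
    ((hσ.eventually_ge_atTop 0).mono fun i hi => h.antitone hF hi) h.isOpen h.anti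
    (fun z hz => (h.tendsto z hz).comp hσ) hz₀ (hy.congr fun i => ?_)
  rw [mul_div_cancel₀ _ (h.pos _).ne', sub_add_cancel]

theorem TailScaling.tendsto_tail (hF : IsDF F) (h : TailScaling F α β τ J) {σ y : ι → ℝ} {z₀ : ℝ}
    (hσ : Tendsto σ l atTop) (hz₀ : z₀ ∈ J)
    (hy : Tendsto (fun i => (y i - β (σ i)) / α (σ i)) l (𝓝 z₀)) :
    Tendsto (fun i => σ i * (1 - F (y i))) l (𝓝 (τ z₀)) := by
  refine (tendsto_apply_of_antitone
    (φ := fun i z => σ i * (1 - F (α (σ i) * z + β (σ i))))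
    ((hσ.eventually_ge_atTop 0).mono fun i hi => h.antitone hF hi) h.isOpen h.cont
    (fun z hz => (h.tendsto z hz).comp hσ) hz₀ hy).congr fun i => ?_
  rw [mul_div_cancel₀ _ (h.pos _).ne', sub_add_cancel]

end Scaling

/-! The quantile function. -/

theorem IsDF.apply_genInv {F : ℝ → ℝ} (hF : IsDF F) (hc : Continuous F) {p : ℝ} (h0 : 0 < p)
    (h1 : p < 1) : F (genInv F p) = p := by
  obtain ⟨x, hx⟩ := hF.exists_eq hc h0 h1
  have hcl : IsClosed {x : ℝ | p ≤ F x} := isClosed_le continuous_const hc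
  have hbdd : BddBelow {x : ℝ | p ≤ F x} := by
    obtain ⟨y, hy⟩ := (hF.tendsto_atBot.eventually (gt_mem_nhds h0)).exists
    refine ⟨y, fun z hz => ?_⟩
    by_contra hlt
    exact absurd (hF.mono (not_le.1 hlt).le) (not_le.2 (hy.trans_le hz))
  have hm := hcl.csInf_mem ⟨x, hx.ge⟩ hbdd
  exact le_antisymm ((hF.mono (csInf_le hbdd hx.ge)).trans hx.le) hm

theorem IsDF.lt_of_apply_lt {F : ℝ → ℝ} (hF : IsDF F) {x y : ℝ} (h : F x < F y) : x < y := by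
  by_contra hlt
  exact absurd (hF.mono (not_lt.1 hlt)) (not_le.2 h)

/-- The tail quantile function `s ↦ F⁻(1 - 1/s)`. -/
noncomputable def tailQuantile (F : ℝ → ℝ) (s : ℝ) : ℝ := genInv F (1 - 1 / s)

section Quantile

variable {F : ℝ → ℝ}

theorem apply_tailQuantile (hF : IsDF F) (hc : Continuous F) {s : ℝ} (hs : 1 < s) :
    F (tailQuantile F s) = 1 - 1 / s := by
  have h0 : 0 < 1 / s := by positivity
  have h1 : 1 / s < 1 := (div_lt_one (by linarith)).2 hs
  exact hF.apply_genInv hc (by linarith) (by linarith)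

theorem apply_tailQuantile_lt_one (hF : IsDF F) (hc : Continuous F) {s : ℝ} (hs : 1 < s) :
    F (tailQuantile F s) < 1 := by
  rw [apply_tailQuantile hF hc hs]
  have : 0 < 1 / s := by positivity
  linarith

theorem tailQuantile_lt (hF : IsDF F) (hc : Continuous F) {s t : ℝ} (hs : 1 < s) (ht : s < t) :
    tailQuantile F s < tailQuantile F t := by
  refine hF.lt_of_apply_lt ?_
  rw [apply_tailQuantile hF hc hs, apply_tailQuantile hF hc (hs.trans ht)]
  have := one_div_lt_one_div_of_lt (by linarith) ht
  linarith

theorem tailQuantile_le (hF : IsDF F) (hc : Continuous F) {s t : ℝ} (hs : 1 < s) (ht : s ≤ t) :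
    tailQuantile F s ≤ tailQuantile F t := by
  rcases ht.eq_or_lt with rfl | h
  · exact le_rfl
  · exact (tailQuantile_lt hF hc hs h).le

theorem locBounded_tailQuantile (hF : IsDF F) (hc : Continuous F) :
    LocBounded (tailQuantile F) := fun _ =>
  ⟨_, fun _ hs => abs_le_max_abs_abs (tailQuantile_le hF hc one_lt_two hs.1)
    (tailQuantile_le hF hc (one_lt_two.trans_le hs.1) hs.2)⟩

theorem mul_tail_tailQuantile (hF : IsDF F) (hc : Continuous F) {u : ℝ} (hu : 0 < u) :
    Tendsto (fun s => s * (1 - F (tailQuantile F (u * s)))) atTop (𝓝 (1 / u)) := by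
  refine tendsto_const_nhds.congr' ?_
  filter_upwards [eventually_gt_atTop 0,
    (tendsto_id.const_mul_atTop hu).eventually_gt_atTop 1] with s h0 h1
  have h1 : 1 < u * s := h1
  rw [apply_tailQuantile hF hc h1]
  field_simp
  ring

theorem eventually_lt_tailQuantile (hF : IsDF F) (hc : Continuous F) {y : ℝ} (hy : F y < 1) :
    ∀ᶠ s in atTop, y < tailQuantile F s := by
  have h : Tendsto (fun s : ℝ => 1 - 1 / s) atTop (𝓝 1) := by
    have := (tendsto_inv_atTop_zero (𝕜 := ℝ)).const_sub 1
    simpa using this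
  filter_upwards [h.eventually (lt_mem_nhds hy), eventually_gt_atTop 1] with s h1 h2
  exact hF.lt_of_apply_lt (by rwa [apply_tailQuantile hF hc h2])

variable {α β τ : ℝ → ℝ} {J : Set ℝ}

theorem TailScaling.tendsto_tailQuantile_mul (hF : IsDF F) (hc : Continuous F)
    (h : TailScaling F α β τ J) {u ζ : ℝ} (hu : 0 < u) (hζ : ζ ∈ J)
    (hτ : τ ζ = 1 / u) :
    Tendsto (fun s => (tailQuantile F (u * s) - β s) / α s) atTop (𝓝 ζ) := by
  refine h.tendsto_arg hF tendsto_id hζ ?_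
  rw [hτ]
  exact mul_tail_tailQuantile hF hc hu

theorem TailScaling.tendsto_tailQuantile (hF : IsDF F) (hc : Continuous F)
    (h : TailScaling F α β τ J) {ζ : ℝ} (hζ : ζ ∈ J) (hτ : τ ζ = 1) :
    Tendsto (fun s => (tailQuantile F s - β s) / α s) atTop (𝓝 ζ) := by
  simpa using h.tendsto_tailQuantile_mul hF hc one_pos hζ (by rw [hτ, div_one])

theorem TailScaling.tendsto_tailQuantile_increment (hF : IsDF F) (hc : Continuous F)
    (h : TailScaling F α β τ J) {ζ₁ ζ₂ : ℝ} (h1 : ζ₁ ∈ J)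
    (h2 : ζ₂ ∈ J) (hτ1 : τ ζ₁ = 1) (hτ2 : τ ζ₂ = 1 / 2) :
    Tendsto (fun s => (tailQuantile F (2 * s) - tailQuantile F s) / α s) atTop
      (𝓝 (ζ₂ - ζ₁)) := by
  refine ((h.tendsto_tailQuantile_mul hF hc two_pos h2 hτ2).sub
    (h.tendsto_tailQuantile hF hc h1 hτ1)).congr fun s => ?_
  rw [← sub_div, sub_sub_sub_cancel_right]

/-- The increment V(4s) - V(2s) of the tail quantile is measured both in units of α(s) and in units
of α(2s); dividing the two limits cancels it. -/
theorem TailScaling.tendsto_scale_ratio (hF : IsDF F) (hc : Continuous F)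
    (h : TailScaling F α β τ J) {ζ₁ ζ₂ ζ₄ : ℝ} (h1 : ζ₁ ∈ J)
    (h2 : ζ₂ ∈ J) (h4 : ζ₄ ∈ J) (hτ1 : τ ζ₁ = 1) (hτ2 : τ ζ₂ = 1 / 2) (hτ4 : τ ζ₄ = 1 / 4)
    (hne : ζ₂ ≠ ζ₁) :
    Tendsto (fun s => α (2 * s) / α s) atTop (𝓝 ((ζ₄ - ζ₂) / (ζ₂ - ζ₁))) := by
  have e1 := (h.tendsto_tailQuantile_mul hF hc four_pos h4 hτ4).sub
    (h.tendsto_tailQuantile_mul hF hc two_pos h2 hτ2)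
  have e2 := (h.tendsto_tailQuantile_increment hF hc h1 h2 hτ1 hτ2).comp
    (tendsto_id.const_mul_atTop (two_pos (α := ℝ)))
  refine (e1.div e2 (sub_ne_zero.2 hne)).congr' ?_
  filter_upwards [eventually_gt_atTop 1] with s hs
  have h3 : tailQuantile F (2 * s) < tailQuantile F (4 * s) :=
    tailQuantile_lt hF hc (by linarith) (by linarith)
  have e : 2 * (2 * s) = 4 * s := by ring
  have p1 := h.pos s
  have p2 := h.pos (2 * s)
  have p3 := (sub_pos.2 h3).ne'
  simp only [Function.comp_apply, id, Pi.div_apply, e]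
  rw [← sub_div, sub_sub_sub_cancel_right, div_div_div_eq, mul_comm, mul_div_mul_right _ _ p3]

end Quantile

/-! The Fréchet and Weibull cases. -/

theorem frechetDF_of_pos (α : ℝ) {x : ℝ} (hx : 0 < x) :
    frechetDF α x = Real.exp (-(x ^ (-α))) := if_pos hx

theorem continuousOn_frechet_exponent (α : ℝ) :
    ContinuousOn (fun x : ℝ => x ^ (-α)) (Set.Ioi 0) :=
  continuousOn_id.rpow_const fun _ hx => Or.inl (ne_of_gt hx)

theorem continuousAt_frechetDF (α : ℝ) {x : ℝ} (hx : 0 < x) : ContinuousAt (frechetDF α) x := by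
  have h := (continuousOn_frechet_exponent α).continuousAt (Ioi_mem_nhds hx)
  refine (h.neg.rexp).congr ?_
  filter_upwards [Ioi_mem_nhds hx] with y hy
  exact (frechetDF_of_pos α hy).symm

theorem weibullDF_of_neg (α : ℝ) {x : ℝ} (hx : x < 0) :
    weibullDF α x = Real.exp (-(|x| ^ α)) := if_pos hx

theorem continuousOn_weibull_exponent (α : ℝ) :
    ContinuousOn (fun x : ℝ => |x| ^ α) (Set.Iio 0) :=
  continuous_abs.continuousOn.rpow_const fun _ hx => Or.inl (abs_pos.2 (ne_of_lt hx)).ne'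

theorem continuousAt_weibullDF (α : ℝ) {x : ℝ} (hx : x < 0) : ContinuousAt (weibullDF α) x := by
  have h := (continuousOn_weibull_exponent α).continuousAt (Iio_mem_nhds hx)
  refine (h.neg.rexp).congr ?_
  filter_upwards [Iio_mem_nhds hx] with y hy
  exact (weibullDF_of_neg α hy).symm

section Domains

variable {F : ℝ → ℝ} {α : ℝ} {a b : ℕ → ℝ}

theorem MaxConverges.tailScaling_frechet (hF : IsDF F) (hα : 0 < α) (ha : ∀ n, 0 < a n)
    (h : MaxConverges F (frechetDF α) a b) :
    TailScaling F (fun s => a ⌊s⌋₊) (fun s => b ⌊s⌋₊) (fun x => x ^ (-α)) (Set.Ioi 0) where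
  pos _ := ha _
  isOpen := isOpen_Ioi
  anti _ hx _ _ hxy := Real.rpow_lt_rpow_of_neg hx hxy (neg_neg_of_pos hα)
  cont := continuousOn_frechet_exponent α
  tendsto _ hz := h.tendsto_floor hF (continuousAt_frechetDF α hz) (frechetDF_of_pos α hz)

theorem MaxConverges.tailScaling_weibull (hF : IsDF F) (hα : 0 < α) (ha : ∀ n, 0 < a n)
    (h : MaxConverges F (weibullDF α) a b) :
    TailScaling F (fun s => a ⌊s⌋₊) (fun s => b ⌊s⌋₊) (fun x => |x| ^ α) (Set.Iio 0) where
  pos _ := ha _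
  isOpen := isOpen_Iio
  anti x hx y hy hxy := by
    have hx' : x < 0 := hx
    have hy' : y < 0 := hy
    refine Real.rpow_lt_rpow (abs_nonneg y) ?_ hα
    rw [abs_of_neg hx', abs_of_neg hy']
    linarith
  cont := continuousOn_weibull_exponent α
  tendsto _ hz := h.tendsto_floor hF (continuousAt_weibullDF α hz) (weibullDF_of_neg α hz)

theorem MaxConverges.tailScaling_gumbel (hF : IsDF F) (ha : ∀ n, 0 < a n)
    (h : MaxConverges F gumbelDF a b) :
    TailScaling F (fun s => a ⌊s⌋₊) (fun s => b ⌊s⌋₊) (fun x => Real.exp (-x)) Set.univ where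
  pos _ := ha _
  isOpen := isOpen_univ
  anti _ _ _ _ hxy := Real.exp_lt_exp.2 (neg_lt_neg hxy)
  cont := by fun_prop
  tendsto z _ := h.tendsto_floor hF (by unfold gumbelDF; fun_prop) rfl

theorem frechet_quantile {u : ℝ} (hα : 0 < α) (hu : 0 < u) :
    (u ^ (1 / α)) ^ (-α) = 1 / u := by
  rw [← Real.rpow_mul hu.le, mul_neg, one_div_mul_cancel hα.ne', Real.rpow_neg_one, one_div]

theorem weibull_quantile {u : ℝ} (hα : 0 < α) (hu : 0 < u) :
    |-(u ^ (-(1 / α)))| ^ α = 1 / u := by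
  rw [abs_neg, abs_of_pos (Real.rpow_pos_of_pos hu _), ← Real.rpow_mul hu.le, neg_mul,
    one_div_mul_cancel hα.ne', Real.rpow_neg_one, one_div]

theorem four_rpow (x : ℝ) : (4 : ℝ) ^ x = 2 ^ x * 2 ^ x := by
  rw [← Real.mul_rpow zero_le_two zero_le_two]; norm_num

/-- The points ζ_u = u^{1/α} give increment q - 1 and scale ratio q = 2^{1/α}, so V/a → (q - 1)/(q -
1) = 1. -/
theorem frechet_tailQuantile (hF : IsDF F) (hc : Continuous F) (hα : 0 < α) (ha : ∀ n, 0 < a n)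
    (h : MaxConverges F (frechetDF α) a b) :
    Tendsto (tailQuantile F) atTop atTop ∧ ∀ x, 0 < x →
      Tendsto (fun s => s * (1 - F (tailQuantile F s * x))) atTop (𝓝 (x ^ (-α))) := by
  have H := h.tailScaling_frechet hF hα ha
  set q : ℝ := 2 ^ (1 / α)
  have hq1 : 1 < q := Real.one_lt_rpow one_lt_two (by positivity)
  have m1 : (1 : ℝ) ∈ Set.Ioi (0 : ℝ) := Set.mem_Ioi.2 one_pos
  have m2 : q ∈ Set.Ioi (0 : ℝ) := one_pos.trans hq1
  have m4 : (4 : ℝ) ^ (1 / α) ∈ Set.Ioi (0 : ℝ) := Real.rpow_pos_of_pos four_pos _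
  have t1 := Real.one_rpow (-α)
  have t2 := frechet_quantile hα two_pos
  have hA := H.tendsto_tailQuantile_increment hF hc m1 m2 t1 t2
  have hq := H.tendsto_scale_ratio hF hc m1 m2 m4 t1 t2 (frechet_quantile hα four_pos) hq1.ne'
  have e : ((4 : ℝ) ^ (1 / α) - q) / (q - 1) = q := by
    rw [four_rpow, div_eq_iff (by linarith)]
    change q * q - q = _
    ring
  rw [e] at hq
  have hκ0 : ∀ᶠ s : ℝ in atTop, 0 < a ⌊s⌋₊ := Eventually.of_forall H.pos
  have hκt := tendsto_atTop_of_doubling hκ0 (locBounded_comp_floor a)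
    (exists_pos_le_comp_floor ha) hq hq1
  have hV := tendsto_div_of_doubling_expanding hκ0 (locBounded_comp_floor a)
    (locBounded_tailQuantile hF hc) hκt hA hq hq1
  rw [div_self (by linarith)] at hV
  refine ⟨?_, fun x hx => ?_⟩
  · refine (hV.pos_mul_atTop one_pos hκt).congr fun s => ?_
    exact div_mul_cancel₀ _ (H.pos s).ne'
  · refine H.tendsto_tail hF tendsto_id hx ?_
    -- (Vx - b)/a = (V - b)/a + (x - 1)V/a → 1 + (x - 1), so V serves as scale with centre 0.
    have := (H.tendsto_tailQuantile hF hc m1 t1).add (hV.const_mul (x - 1))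
    rw [mul_one, add_sub_cancel] at this
    refine this.congr fun s => ?_
    have := H.pos s
    field_simp
    ring

theorem apply_eq_one_of_eventually_le (hF : IsDF F) (hc : Continuous F) {K : ℝ}
    (hK : ∀ᶠ s in atTop, tailQuantile F s ≤ K) : F K = 1 := by
  refine ((hF.le_one K).lt_or_eq).resolve_left fun h1 => ?_
  obtain ⟨s, hs1, hs2⟩ := (hK.and (eventually_lt_tailQuantile hF hc h1)).exists
  exact absurd hs2 hs1.not_gt

theorem coe_toReal_rightExt (hF : IsDF F) (hc : Continuous F) {K : ℝ} (hK : F K = 1) :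
    (((rightExt F).toReal : ℝ) : EReal) = rightExt F := by
  refine EReal.coe_toReal ?_ ?_
  · exact ((not_lt.1 ((lt_rightExt_iff hF hc).not.2 (by rw [hK]; exact lt_irrefl _))).trans_lt
      (EReal.coe_lt_top K)).ne
  · obtain ⟨x, hx⟩ := hF.exists_lt_one
    exact ((EReal.bot_lt_coe x).trans ((lt_rightExt_iff hF hc).2 hx)).ne'

/-- Here ζ_u = -u^{-1/α} and q = 2^{-1/α} < 1: V is bounded, which forces F to reach 1, and then (r
- V)/a → 1. -/
theorem weibull_tailQuantile (hF : IsDF F) (hc : Continuous F) (hα : 0 < α) (ha : ∀ n, 0 < a n)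
    (h : MaxConverges F (weibullDF α) a b) :
    (∃ K, F K = 1) ∧ ∀ x, x < 0 →
      Tendsto (fun s => s * (1 - F (((rightExt F).toReal - tailQuantile F s) * x
        + (rightExt F).toReal))) atTop (𝓝 (|x| ^ α)) := by
  have H := h.tailScaling_weibull hF hα ha
  set q : ℝ := 2 ^ (-(1 / α))
  have hq0 : 0 < q := Real.rpow_pos_of_pos two_pos _
  have hq1 : q < 1 := Real.rpow_lt_one_of_one_lt_of_neg one_lt_two
    (neg_neg_of_pos (by positivity))
  have m1 : (-1 : ℝ) ∈ Set.Iio (0 : ℝ) := Set.mem_Iio.2 neg_one_lt_zero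
  have m2 : -q ∈ Set.Iio (0 : ℝ) := neg_neg_of_pos hq0
  have m4 : -(4 : ℝ) ^ (-(1 / α)) ∈ Set.Iio (0 : ℝ) :=
    neg_neg_of_pos (Real.rpow_pos_of_pos four_pos _)
  have t1 : |(-1 : ℝ)| ^ α = 1 := by simp
  have t2 := weibull_quantile hα two_pos
  have hA := H.tendsto_tailQuantile_increment hF hc m1 m2 t1 t2
  have hq := H.tendsto_scale_ratio hF hc m1 m2 m4 t1 t2 (weibull_quantile hα four_pos)
    (by intro h; linarith)
  have e : (-(4 : ℝ) ^ (-(1 / α)) - -q) / (-q - -1) = q := by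
    rw [four_rpow, div_eq_iff (by linarith)]
    change -(q * q) - -q = _
    ring
  rw [e] at hq
  have hκ0 : ∀ᶠ s : ℝ in atTop, 0 < a ⌊s⌋₊ := Eventually.of_forall H.pos
  obtain ⟨K, hK⟩ := exists_bound_of_doubling_contracting hκ0 (locBounded_comp_floor a)
    (locBounded_tailQuantile hF hc) hA hq hq1
  have hFK := apply_eq_one_of_eventually_le hF hc hK
  refine ⟨⟨K, hFK⟩, fun x hx => ?_⟩
  have hr := coe_toReal_rightExt hF hc hFK
  set r := (rightExt F).toReal
  have hlt : ∀ y, F y < 1 ↔ y < r := fun y => by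
    rw [← lt_rightExt_iff hF hc, ← hr, EReal.coe_lt_coe_iff]
  have hVr : Tendsto (tailQuantile F) atTop (𝓝 r) := by
    refine tendsto_order.2 ⟨fun y hy => eventually_lt_tailQuantile hF hc ((hlt y).2 hy),
      fun y hy => ?_⟩
    filter_upwards [eventually_gt_atTop 1] with s hs
    exact ((hlt _).1 (apply_tailQuantile_lt_one hF hc hs)).trans hy
  have hV := tendsto_sub_div_of_doubling_contracting hκ0 hVr (by intro h; linarith) hA hq hq1
  have e2 : (-q - -1) / (1 - q) = 1 := by rw [div_eq_one_iff_eq (by linarith)]; ring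
  rw [e2] at hV
  refine H.tendsto_tail hF tendsto_id hx ?_
  -- ((r - V)x + r - b)/a = (V - b)/a + (x + 1)(r - V)/a → -1 + (x + 1).
  have := (H.tendsto_tailQuantile hF hc m1 t1).add (hV.const_mul (x + 1))
  have e3 : -1 + (x + 1) * 1 = x := by ring
  rw [e3] at this
  refine this.congr fun s => ?_
  have := H.pos s
  field_simp
  ring

end Domains

/-! ### The Gumbel case: integrability of the tail and auxiliary functions. -/

section Gumbel

variable {F : ℝ → ℝ}

theorem IsDF.intervalIntegrable_tail (hF : IsDF F) (a b : ℝ) :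
    IntervalIntegrable (fun s => 1 - F s) volume a b :=
  Antitone.intervalIntegrable fun _ _ h => sub_le_sub_left (hF.mono h) 1

theorem IsDF.integral_tail_mono (hF : IsDF F) (c : ℝ) :
    Monotone fun x => ∫ s in c..x, (1 - F s) := fun x y hxy => by
  have h := intervalIntegral.integral_add_adjacent_intervals (hF.intervalIntegrable_tail c x)
    (hF.intervalIntegrable_tail x y)
  have h2 : 0 ≤ ∫ s in x..y, (1 - F s) :=
    intervalIntegral.integral_nonneg hxy fun s _ => sub_nonneg.2 (hF.le_one s)
  dsimp only
  linarith

/-- The limit is ∫_0^{log 2} e^{-z} dz. Antitonicity and φ_s(-1) → e give the common bound e + 1 on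
z ≥ -1, which serves both dominated convergence and the vanishing end pieces. -/
theorem tendsto_integral_of_antitone {φ : ℝ → ℝ → ℝ} {z₁ z₂ : ℝ → ℝ}
    (hφ : ∀ᶠ s in atTop, Antitone (φ s)) (hφ0 : ∀ᶠ s in atTop, ∀ z, 0 ≤ φ s z)
    (h : ∀ z, Tendsto (fun s => φ s z) atTop (𝓝 (Real.exp (-z))))
    (h1 : Tendsto z₁ atTop (𝓝 0)) (h2 : Tendsto z₂ atTop (𝓝 (Real.log 2))) :
    Tendsto (fun s => ∫ z in (z₁ s)..(z₂ s), φ s z) atTop (𝓝 (1 / 2)) := by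
  have hlog : 0 < Real.log 2 := Real.log_pos one_lt_two
  set C := Real.exp 1 + 1
  have hC : ∀ᶠ s in atTop, ∀ z, -1 ≤ z → ‖φ s z‖ ≤ C := by
    have h3 := h (-1)
    rw [neg_neg] at h3
    filter_upwards [hφ, hφ0, h3.eventually (gt_mem_nhds (lt_add_one _))] with s e1 e2 e3 z hz
    rw [Real.norm_of_nonneg (e2 z)]
    exact (e1 hz).trans e3.le
  have hint : ∀ᶠ s in atTop, ∀ a b, IntervalIntegrable (φ s) volume a b :=
    hφ.mono fun s hs a b => hs.intervalIntegrable
  have hmid : Tendsto (fun s => ∫ z in (0 : ℝ)..Real.log 2, φ s z) atTop (𝓝 (1 / 2)) := by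
    have e : ∫ z in (0 : ℝ)..Real.log 2, Real.exp (-z) = 1 / 2 := by
      rw [intervalIntegral.integral_comp_neg, integral_exp, neg_zero, Real.exp_zero, Real.exp_neg,
        Real.exp_log two_pos]
      norm_num
    rw [← e]
    refine intervalIntegral.tendsto_integral_filter_of_dominated_convergence (fun _ => C) ?_ ?_
      (by simp) (Eventually.of_forall fun z _ => h z)
    · filter_upwards [hφ] with s hs
      exact hs.measurable.aestronglyMeasurable
    · filter_upwards [hC] with s hs
      refine Eventually.of_forall fun z hz => hs z ?_
      rw [Set.uIoc_of_le hlog.le] at hz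
      linarith [hz.1]
  have hsmall : ∀ {x y : ℝ → ℝ}, Tendsto (fun s => y s - x s) atTop (𝓝 0) →
      (∀ᶠ s in atTop, -1 ≤ x s) → (∀ᶠ s in atTop, -1 ≤ y s) →
      Tendsto (fun s => ∫ z in (x s)..(y s), φ s z) atTop (𝓝 0) := by
    intro x y hxy hx hy
    have hlim : Tendsto (fun s => C * |y s - x s|) atTop (𝓝 0) := by
      simpa using hxy.abs.const_mul C
    refine squeeze_zero_norm' ?_ hlim
    filter_upwards [hC, hx, hy] with s e1 e2 e3
    refine intervalIntegral.norm_integral_le_of_norm_le_const fun z hz => e1 z ?_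
    exact (le_min e2 e3).trans (Set.mem_uIoc.1 hz |>.elim (fun h => (min_le_left _ _).trans h.1.le)
      fun h => (min_le_right _ _).trans h.1.le)
  have e1 := h1.eventually (lt_mem_nhds (neg_one_lt_zero (R := ℝ)))
  have e2 := h2.eventually (lt_mem_nhds (neg_one_lt_zero.trans hlog))
  have l1 := hsmall (x := z₁) (y := fun _ => 0) (by simpa using h1.const_sub 0)
    (e1.mono fun _ => le_of_lt) (Eventually.of_forall fun _ => by norm_num)
  have l2 := hsmall (x := fun _ => Real.log 2) (y := z₂) (by simpa using h2.sub_const (Real.log 2))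
    (Eventually.of_forall fun _ => by linarith) (e2.mono fun _ => le_of_lt)
  have := (l1.add hmid).add l2
  rw [zero_add, add_zero] at this
  refine this.congr' ?_
  filter_upwards [hint] with s hs
  rw [intervalIntegral.integral_add_adjacent_intervals (hs _ _) (hs _ _),
    intervalIntegral.integral_add_adjacent_intervals (hs _ _) (hs _ _)]

theorem IsDF.integrableOn_tail_of_bound (hF : IsDF F) (hc : Continuous F) {K : ℝ}
    (hK : ∀ᶠ s in atTop, ∫ x in (0 : ℝ)..tailQuantile F s, (1 - F x) ≤ K) (t : ℝ) :
    IntegrableOn (fun s => 1 - F s) (Set.Ioi t) := by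
  have hloc : ∀ a b, IntegrableOn (fun s => 1 - F s) (Set.Ioc a b) := fun a b =>
    (hF.intervalIntegrable_tail a b).1
  have hmain : ∃ y, IntegrableOn (fun s => 1 - F s) (Set.Ioi y) := by
    by_cases h1 : ∃ y, F y = 1
    · obtain ⟨y, hy⟩ := h1
      refine ⟨y, (integrableOn_zero (ε' := ℝ)).congr_fun (fun s hs => ?_) measurableSet_Ioi⟩
      have := hF.mono (le_of_lt (Set.mem_Ioi.1 hs))
      have := hF.le_one s
      dsimp only
      linarith
    · have h2 : ∀ y, F y < 1 := fun y => (hF.le_one y).lt_of_ne fun h => h1 ⟨y, h⟩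
      refine ⟨0, integrableOn_Ioi_of_intervalIntegral_norm_bounded K 0 (fun i => hloc 0 i)
        tendsto_id (Eventually.of_forall fun i => ?_)⟩
      obtain ⟨s, hs1, hs2⟩ := (hK.and (eventually_lt_tailQuantile hF hc (h2 i))).exists
      have e : (fun x => ‖1 - F x‖) = fun x => 1 - F x := by
        funext x; exact Real.norm_of_nonneg (sub_nonneg.2 (hF.le_one x))
      rw [e]
      exact (hF.integral_tail_mono 0 hs2.le).trans hs1
  obtain ⟨y, hy⟩ := hmain
  exact ((hloc t y).union hy).mono_set fun s hs => by
    rcases le_or_gt s y with h | h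
    · exact Or.inl ⟨hs, h⟩
    · exact Or.inr h

theorem tendsto_integral_Ioi_tailQuantile (hF : IsDF F) (hc : Continuous F)
    (hi : ∀ t, IntegrableOn (fun s => 1 - F s) (Set.Ioi t)) :
    Tendsto (fun s => ∫ x in Set.Ioi (tailQuantile F s), (1 - F x)) atTop (𝓝 0) := by
  have e : ∀ s, ∫ x in Set.Ioi (tailQuantile F s), (1 - F x)
      = ∫ x, (Set.Ioi (tailQuantile F s)).indicator (fun x => 1 - F x) x := fun s =>
    (integral_indicator measurableSet_Ioi).symm
  simp_rw [e]
  rw [← integral_zero ℝ ℝ]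
  have hT : ∀ x, 0 ≤ 1 - F x := fun x => sub_nonneg.2 (hF.le_one x)
  refine tendsto_integral_filter_of_dominated_convergence
    ((Set.Ioi (tailQuantile F 2)).indicator fun x => 1 - F x) ?_ ?_ ?_ ?_
  · exact Eventually.of_forall fun s =>
      ((hi _).integrable_indicator measurableSet_Ioi).aestronglyMeasurable
  · filter_upwards [eventually_ge_atTop 2] with s hs
    refine Eventually.of_forall fun x => ?_
    rw [Real.norm_of_nonneg (Set.indicator_nonneg (fun x _ => hT x) x)]
    exact Set.indicator_le_indicator_of_subset
      (Set.Ioi_subset_Ioi (tailQuantile_le hF hc one_lt_two hs)) hT x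
  · exact (hi _).integrable_indicator measurableSet_Ioi
  · refine Eventually.of_forall fun x => ?_
    refine tendsto_of_tendsto_of_tendsto_of_le_of_le' tendsto_const_nhds
      (tendsto_inv_atTop_zero (𝕜 := ℝ)) ?_ ?_
    · exact Eventually.of_forall fun s => Set.indicator_nonneg (fun x _ => hT x) x
    · filter_upwards [eventually_gt_atTop 1] with s hs
      refine Set.indicator_apply_le' (fun hx => ?_) fun _ => by positivity
      have h1 := hF.mono (le_of_lt (Set.mem_Ioi.1 hx))
      rw [apply_tailQuantile hF hc hs, one_div] at h1
      linarith

/-- The reciprocal tail `1 / (1 - F)` tends to infinity at the right extremity. -/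
theorem tendsto_one_div_tail (hF : IsDF F) (hc : Continuous F) :
    Tendsto (fun t => 1 / (1 - F t)) (toRightExt F) atTop := by
  have h : Tendsto (fun p : ℝ => 1 - p) (𝓝[<] 1) (𝓝[>] 0) := by
    refine tendsto_nhdsWithin_iff.2 ⟨?_, ?_⟩
    · have : Continuous fun p : ℝ => 1 - p := by fun_prop
      have := this.tendsto 1
      rw [sub_self] at this
      exact this.mono_left nhdsWithin_le_nhds
    · filter_upwards [self_mem_nhdsWithin] with p hp
      exact Set.mem_Ioi.2 (sub_pos.2 hp)
  simp only [one_div]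
  exact (h.comp (tendsto_toRightExt hF hc)).inv_tendsto_nhdsGT_zero

theorem eventually_lt_one_toRightExt (hF : IsDF F) (hc : Continuous F) :
    ∀ᶠ t in toRightExt F, F t < 1 :=
  (tendsto_toRightExt hF hc).eventually self_mem_nhdsWithin

variable {α β : ℝ → ℝ}

/-- At level σ = 1/(1 - F(t)) one has σ(1 - F(t)) = 1 = e^{-0}, so t itself may replace the centre
β(σ). -/
theorem TailScaling.tendsto_center (hF : IsDF F) (hc : Continuous F)
    (h : TailScaling F α β (fun x => Real.exp (-x)) Set.univ) :
    Tendsto (fun t => (t - β (1 / (1 - F t))) / α (1 / (1 - F t))) (toRightExt F) (𝓝 0) := by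
  refine h.tendsto_arg hF (tendsto_one_div_tail hF hc) (Set.mem_univ 0) ?_
  rw [neg_zero, Real.exp_zero]
  refine tendsto_const_nhds.congr' ?_
  filter_upwards [eventually_lt_one_toRightExt hF hc] with t ht
  exact (one_div_mul_cancel (sub_pos.2 ht).ne').symm

theorem TailScaling.tendsto_tail_ratio (hF : IsDF F) (hc : Continuous F)
    (h : TailScaling F α β (fun x => Real.exp (-x)) Set.univ) {v : ℝ → ℝ}
    (hv : Tendsto (fun t => v t / α (1 / (1 - F t))) (toRightExt F) (𝓝 1)) (x : ℝ) :
    Tendsto (fun t => (1 - F (t + v t * x)) / (1 - F t)) (toRightExt F)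
      (𝓝 (Real.exp (-x))) := by
  refine (h.tendsto_tail hF (y := fun t => t + v t * x) (tendsto_one_div_tail hF hc)
    (Set.mem_univ x) ?_).congr fun t => ?_
  · have := (h.tendsto_center hF hc).add (hv.mul_const x)
    rw [one_mul, zero_add] at this
    refine this.congr fun t => ?_
    ring
  · ring

/-- The single value x = 1 already determines an auxiliary function up to asymptotic equivalence. -/
theorem TailScaling.tendsto_auxiliary_div (hF : IsDF F) (hc : Continuous F)
    (h : TailScaling F α β (fun x => Real.exp (-x)) Set.univ) {v : ℝ → ℝ}
    (hv : IsAuxiliary F v) :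
    Tendsto (fun t => v t / α (1 / (1 - F t))) (toRightExt F) (𝓝 1) := by
  have h1 := h.tendsto_arg hF (y := fun t => t + v t * 1) (tendsto_one_div_tail hF hc)
    (Set.mem_univ 1) ((hv.2 1 zero_le_one).congr fun t => by ring)
  have := h1.sub (h.tendsto_center hF hc)
  rw [sub_zero] at this
  refine this.congr fun t => ?_
  ring

theorem gumbel_quantile {u : ℝ} (hu : 0 < u) : Real.exp (-Real.log u) = 1 / u := by
  rw [Real.exp_neg, Real.exp_log hu, one_div]

theorem log_four : Real.log 4 = 2 * Real.log 2 := by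
  rw [show (4 : ℝ) = 2 ^ 2 by norm_num, Real.log_pow]; norm_num

/-- The substitution x = α(s)z + β(s) turns the increment, divided by α(s)/s, into an integral of
rescaled tails over an interval tending to [0, log 2]. The second ratio is 1/2 because α(2s)/α(s) →
1. -/
theorem TailScaling.gumbel_doubling (hF : IsDF F) (hc : Continuous F)
    (h : TailScaling F α β (fun x => Real.exp (-x)) Set.univ) :
    Tendsto (fun s => ((∫ x in (0 : ℝ)..tailQuantile F (2 * s), (1 - F x))
        - ∫ x in (0 : ℝ)..tailQuantile F s, (1 - F x)) / (α s / s)) atTop (𝓝 (1 / 2)) ∧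
      Tendsto (fun s => (α (2 * s) / (2 * s)) / (α s / s)) atTop (𝓝 (1 / 2)) := by
  have hlog : 0 < Real.log 2 := Real.log_pos one_lt_two
  have t1 : Real.exp (-0) = 1 := by simp
  have t2 := gumbel_quantile two_pos
  constructor
  · have hz1 := h.tendsto_tailQuantile hF hc (Set.mem_univ 0) t1
    have hz2 := h.tendsto_tailQuantile_mul hF hc two_pos (Set.mem_univ _) t2
    refine (tendsto_integral_of_antitone (φ := fun s z => s * (1 - F (α s * z + β s)))
      ((eventually_ge_atTop 0).mono fun s hs => h.antitone hF hs)
      ((eventually_ge_atTop 0).mono fun s hs z => mul_nonneg hs (sub_nonneg.2 (hF.le_one _)))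
      (fun z => h.tendsto z (Set.mem_univ z)) hz1 hz2).congr fun s => ?_
    have hp := (h.pos s).ne'
    have e := intervalIntegral.mul_integral_comp_mul_add (f := fun x => 1 - F x) (α s) (β s)
      (a := (tailQuantile F s - β s) / α s) (b := (tailQuantile F (2 * s) - β s) / α s)
    rw [mul_div_cancel₀ _ hp, mul_div_cancel₀ _ hp, sub_add_cancel, sub_add_cancel] at e
    rw [intervalIntegral.integral_interval_sub_left (hF.intervalIntegrable_tail _ _)
      (hF.intervalIntegrable_tail _ _), ← e, intervalIntegral.integral_const_mul,
      div_div_eq_mul_div]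
    field_simp
  · have hq := h.tendsto_scale_ratio hF hc (Set.mem_univ _) (Set.mem_univ _) (Set.mem_univ _)
      t1 t2 (gumbel_quantile four_pos) hlog.ne'
    rw [log_four, sub_zero, two_mul, add_sub_cancel_right, div_self hlog.ne'] at hq
    have := hq.mul_const (1 / 2)
    rw [one_mul] at this
    refine this.congr' ?_
    filter_upwards [eventually_gt_atTop 0] with s hs
    have hp := (h.pos s).ne'
    field_simp

theorem TailScaling.integrableOn_tail (hF : IsDF F) (hc : Continuous F)
    (h : TailScaling F α β (fun x => Real.exp (-x)) Set.univ) (hα : LocBounded α) (t : ℝ) :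
    IntegrableOn (fun s => 1 - F s) (Set.Ioi t) := by
  obtain ⟨hA, hq⟩ := h.gumbel_doubling hF hc
  have hκ0 : ∀ᶠ s in atTop, 0 < α s / s := by
    filter_upwards [eventually_gt_atTop 0] with s hs using div_pos (h.pos s) hs
  have hκb : LocBounded fun s => α s / s := fun S => by
    obtain ⟨K, hK⟩ := hα S
    refine ⟨K, fun s hs => ?_⟩
    have h2 : (2 : ℝ) ≤ s := hs.1
    rw [abs_div]
    refine (div_le_self (abs_nonneg _) ?_).trans (hK s hs)
    exact le_trans (by linarith) (le_abs_self s)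
  have hPb : LocBounded fun s => ∫ x in (0 : ℝ)..tailQuantile F s, (1 - F x) := fun S =>
    ⟨_, fun s hs => abs_le_max_abs_abs
      (hF.integral_tail_mono 0 (tailQuantile_le hF hc one_lt_two hs.1))
      (hF.integral_tail_mono 0 (tailQuantile_le hF hc (one_lt_two.trans_le hs.1) hs.2))⟩
  obtain ⟨K, hK⟩ := exists_bound_of_doubling_contracting hκ0 hκb hPb hA hq (by norm_num)
  exact hF.integrableOn_tail_of_bound hc hK t

theorem TailScaling.tendsto_meanResidualLife (hF : IsDF F) (hc : Continuous F)
    (h : TailScaling F α β (fun x => Real.exp (-x)) Set.univ)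
    (hi : ∀ t, IntegrableOn (fun s => 1 - F s) (Set.Ioi t)) :
    Tendsto (fun t => meanResidualLife F t / α (1 / (1 - F t))) (toRightExt F) (𝓝 1) := by
  obtain ⟨hA, hq⟩ := h.gumbel_doubling hF hc
  have hκ0 : ∀ᶠ s in atTop, 0 < α s / s := by
    filter_upwards [eventually_gt_atTop 0] with s hs using div_pos (h.pos s) hs
  have hsub : ∀ a b, (∫ x in Set.Ioi a, (1 - F x)) - ∫ x in a..b, (1 - F x)
      = ∫ x in Set.Ioi b, (1 - F x) := fun a b => by
    rw [← intervalIntegral.integral_interval_add_Ioi (hi a) (hi b), add_sub_cancel_left]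
  have hp : Tendsto (fun s => ∫ x in (0 : ℝ)..tailQuantile F s, (1 - F x)) atTop
      (𝓝 (∫ x in Set.Ioi 0, (1 - F x))) := by
    have := (tendsto_integral_Ioi_tailQuantile hF hc hi).const_sub (∫ x in Set.Ioi 0, (1 - F x))
    rw [sub_zero] at this
    refine this.congr fun s => ?_
    rw [← hsub 0 (tailQuantile F s), sub_sub_cancel]
  -- Hence the integral of the tail beyond V(s) is asymptotic to α(s)/s.
  have h1 := tendsto_sub_div_of_doubling_contracting hκ0 hp (by norm_num) hA hq (by norm_num)
  have e : (1 / 2 : ℝ) / (1 - 1 / 2) = 1 := by norm_num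
  rw [e] at h1
  simp_rw [hsub] at h1
  have hσ := tendsto_one_div_tail hF hc
  have h2 := h1.comp hσ
  have h3 : Tendsto (fun t => (t - tailQuantile F (1 / (1 - F t))) / α (1 / (1 - F t)))
      (toRightExt F) (𝓝 0) := by
    have := (h.tendsto_center hF hc).sub
      ((h.tendsto_tailQuantile hF hc (Set.mem_univ 0) (by simp)).comp hσ)
    rw [sub_zero] at this
    refine this.congr fun t => ?_
    simp only [Function.comp_apply]
    rw [← sub_div, sub_sub_sub_cancel_right]
  -- At σ = 1/(1 - F(t)) the quantile V(σ) need not equal t when F has flat pieces; both have the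
  -- same F-value and are o(α(σ)) apart, so the start of integration can be moved to t.
  have h4 : Tendsto (fun t => (1 / (1 - F t)) *
      (∫ x in (tailQuantile F (1 / (1 - F t)))..t, (1 - F x)) / α (1 / (1 - F t)))
      (toRightExt F) (𝓝 0) := by
    have h3' := h3.abs
    rw [abs_zero] at h3'
    refine squeeze_zero_norm' ?_ h3'
    filter_upwards [hσ.eventually_gt_atTop 1, eventually_lt_one_toRightExt hF hc] with t ht ht1
    have hT : 0 < 1 - F t := sub_pos.2 ht1
    have hFV : F (tailQuantile F (1 / (1 - F t))) = F t := by
      rw [apply_tailQuantile hF hc ht, one_div_one_div, sub_sub_cancel]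
    have hb : ‖∫ x in (tailQuantile F (1 / (1 - F t)))..t, (1 - F x)‖
        ≤ (1 - F t) * |t - tailQuantile F (1 / (1 - F t))| := by
      refine intervalIntegral.norm_integral_le_of_norm_le_const fun z hz => ?_
      rw [Real.norm_of_nonneg (sub_nonneg.2 (hF.le_one z))]
      refine sub_le_sub_left ?_ 1
      rcases Set.mem_uIoc.1 hz with h5 | h5
      · rw [← hFV]; exact hF.mono h5.1.le
      · exact hF.mono h5.1.le
    have hα := h.pos (1 / (1 - F t))
    rw [norm_div, norm_mul, Real.norm_of_nonneg (one_div_pos.2 hT).le, Real.norm_of_nonneg hα.le,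
      abs_div, abs_of_pos hα]
    refine div_le_div_of_nonneg_right ?_ hα.le
    rw [one_div_mul_eq_div, div_le_iff₀ hT, mul_comm]
    exact hb
  have h5 := h2.sub h4
  rw [sub_zero] at h5
  refine h5.congr fun t => ?_
  simp only [Function.comp_apply]
  rw [meanResidualLife, ← hsub (tailQuantile F (1 / (1 - F t))) t, div_div_eq_mul_div]
  ring

theorem meanResidualLife_pos (hF : IsDF F) (hc : Continuous F)
    (hi : ∀ t, IntegrableOn (fun s => 1 - F s) (Set.Ioi t)) {t : ℝ} (ht : F t < 1) :
    0 < meanResidualLife F t := by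
  have h1 : ∀ᶠ y in 𝓝[>] t, F y < 1 :=
    (hc.continuousAt.eventually (gt_mem_nhds ht)).filter_mono nhdsWithin_le_nhds
  obtain ⟨y, hy, hty⟩ := (h1.and self_mem_nhdsWithin).exists
  have hty : t < y := hty
  refine div_pos ?_ (sub_pos.2 ht)
  rw [← intervalIntegral.integral_interval_add_Ioi (hi t) (hi y)]
  have h2 : 0 < ∫ x in t..y, (1 - F x) :=
    intervalIntegral.intervalIntegral_pos_of_pos_on (hF.intervalIntegrable_tail t y)
      (fun x hx => sub_pos.2 ((hF.mono hx.2.le).trans_lt hy)) hty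
  have h3 : 0 ≤ ∫ x in Set.Ioi y, (1 - F x) :=
    integral_nonneg fun x => sub_nonneg.2 (hF.le_one x)
  linarith

end Gumbel

/-! ### Transfer of tail limits from F to U_k. -/

section Transfer

variable {F : ℝ → ℝ} {k : ℕ}

/-- The expression is (k+1)! · (1 - U_k)/(1 - F)^k · (t(1 - F))^k, and (b) makes the first two
factors tend to 1. -/
theorem tendsto_tail_upperU (hk : 1 ≤ k) {ι : Type*}
    {l : Filter ι} {t y : ι → ℝ} {c : ℝ} (ht : Tendsto t l atTop) (hcpos : 0 < c)
    (hy : Tendsto (fun i => t i * (1 - F (y i))) l (𝓝 c)) :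
    Tendsto (fun i => ((k + 1).factorial : ℝ) * t i ^ k * (1 - upperU F k (y i))) l
      (𝓝 (c ^ k)) := by
  have ht0 := ht.eventually_gt_atTop 0
  have hlt : ∀ᶠ i in l, F (y i) < 1 := by
    filter_upwards [hy.eventually (lt_mem_nhds hcpos), ht0] with i h1 h2
    exact sub_pos.1 (pos_of_mul_pos_right h1 h2.le)
  have h1 : Tendsto (fun i => F (y i)) l (𝓝[<] 1) := by
    refine tendsto_nhdsWithin_iff.2 ⟨?_, hlt⟩
    have := (hy.div_atTop ht).const_sub 1
    rw [sub_zero] at this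
    refine this.congr' ?_
    filter_upwards [ht0] with i hi
    rw [mul_div_cancel_left₀ _ hi.ne', sub_sub_cancel]
  have h2 := (((tendsto_one_sub_upperKernel_div hk).comp h1).mul (hy.pow k)).const_mul
    ((k + 1).factorial : ℝ)
  have hf : ((k + 1).factorial : ℝ) ≠ 0 := by positivity
  rw [← mul_assoc, mul_one_div_cancel hf, one_mul] at h2
  refine h2.congr' ?_
  filter_upwards [hlt] with i hi
  have : (1 - F (y i)) ^ k ≠ 0 := pow_ne_zero _ (sub_pos.2 hi).ne'
  simp only [Function.comp_apply, upperU_eq]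
  rw [mul_pow]
  field_simp

/-- The argument of the tail quantile function of `F` in the norming constants of `U_k`. -/
noncomputable def normingLevel (k n : ℕ) : ℝ := ((n : ℝ) / ((k + 1).factorial : ℝ)) ^ (1 / (k : ℝ))

theorem tendsto_normingLevel (hk : 1 ≤ k) : Tendsto (normingLevel k) atTop atTop := by
  have hk0 : (0 : ℝ) < k := by exact_mod_cast hk
  exact (tendsto_rpow_atTop (one_div_pos.2 hk0)).comp
    (tendsto_natCast_atTop_atTop.atTop_div_const (by positivity))

theorem factorial_mul_normingLevel_pow (hk : 1 ≤ k) (n : ℕ) :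
    ((k + 1).factorial : ℝ) * normingLevel k n ^ k = n := by
  have hf : ((k + 1).factorial : ℝ) ≠ 0 := by positivity
  rw [normingLevel, one_div, Real.rpow_inv_natCast_pow (by positivity) (by omega),
    mul_div_cancel₀ _ hf]

theorem tailQuantile_normingLevel (F : ℝ → ℝ) (k n : ℕ) :
    genInv F (1 - (((k + 1).factorial : ℝ) / (n : ℝ)) ^ (1 / (k : ℝ)))
      = tailQuantile F (normingLevel k n) := by
  rw [tailQuantile, normingLevel, one_div (_ ^ _), ← Real.inv_rpow (by positivity), inv_div]

theorem tendsto_upperU_pow (hk : 1 ≤ k) {y : ℕ → ℝ} {c : ℝ}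
    (hcpos : 0 < c) (hy : Tendsto (fun n => normingLevel k n * (1 - F (y n))) atTop (𝓝 c)) :
    Tendsto (fun n => upperU F k (y n) ^ n) atTop (𝓝 (Real.exp (-c ^ k))) := by
  refine tendsto_pow_of_tendsto_nat_mul_one_sub ?_
  refine (tendsto_tail_upperU hk (tendsto_normingLevel hk) hcpos hy).congr fun n => ?_
  rw [factorial_mul_normingLevel_pow hk]

/-- `InMaxDomain` wants every scale positive; the finitely many bad ones are replaced by 1. -/
theorem AreNormings.inMaxDomain {F G : ℝ → ℝ} {a b : ℕ → ℝ} (h : AreNormings F G a b) :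
    InMaxDomain F G := by
  refine ⟨fun n => if 0 < a n then a n else 1, b, fun n => ?_, fun x hx => ?_⟩
  · dsimp only
    split_ifs with h1
    · exact h1
    · exact one_pos
  · refine (h.2 x hx).congr' ?_
    filter_upwards [h.1] with n hn
    rw [if_pos hn]

theorem areNormings_frechet (hF : IsDF F) (hc : Continuous F) (hk : 1 ≤ k) {α : ℝ} (hα : 0 < α)
    (h : InMaxDomain F (frechetDF α)) : rightExt F = ⊤ ∧
      AreNormings (upperU F k) (frechetDF (k * α))
        (fun n => tailQuantile F (normingLevel k n)) (fun _ => 0) := by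
  obtain ⟨a, b, ha, h⟩ := h
  obtain ⟨hV, hlim⟩ := frechet_tailQuantile hF hc hα ha h
  have hlt : ∀ y, F y < 1 := fun y => by
    obtain ⟨s, h1, h2⟩ := ((hV.eventually_gt_atTop y).and (eventually_gt_atTop 1)).exists
    exact (hF.mono h1.le).trans_lt (apply_tailQuantile_lt_one hF hc h2)
  have hpos := (hV.comp (tendsto_normingLevel hk)).eventually_gt_atTop 0
  refine ⟨?_, hpos, fun x _ => ?_⟩
  · rw [EReal.eq_top_iff_forall_lt]
    exact fun y => (lt_rightExt_iff hF hc).2 (hlt y)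
  simp only [add_zero]
  rcases lt_or_ge 0 x with hx | hx
  · have := tendsto_upperU_pow hk (Real.rpow_pos_of_pos hx _)
      ((hlim x hx).comp (tendsto_normingLevel hk))
    rw [← Real.rpow_natCast, ← Real.rpow_mul hx.le, neg_mul, mul_comm α] at this
    rw [frechetDF_of_pos _ hx]
    exact this
  · rw [frechetDF, if_neg hx.not_gt]
    have hU := hF.comp_upperKernel hc hk
    refine squeeze_zero' (Eventually.of_forall fun n => pow_nonneg (hU.nonneg _) n) ?_
      -- For x ≤ 0 the argument is at most 0, and U_k(0) < 1 because r(F) = ∞.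
      (tendsto_pow_atTop_nhds_zero_of_lt_one (hU.nonneg 0) (upperKernel_lt_one hk (hlt 0)))
    filter_upwards [hpos] with n hn
    exact pow_le_pow_left₀ (hU.nonneg _) (hU.mono (mul_nonpos_of_nonneg_of_nonpos hn.le hx)) n

theorem areNormings_weibull (hF : IsDF F) (hc : Continuous F) (hk : 1 ≤ k) {α : ℝ} (hα : 0 < α)
    (h : InMaxDomain F (weibullDF α)) : rightExt F < ⊤ ∧
      AreNormings (upperU F k) (weibullDF (k * α))
        (fun n => (rightExt F).toReal - tailQuantile F (normingLevel k n))
        (fun _ => (rightExt F).toReal) := by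
  obtain ⟨a, b, ha, h⟩ := h
  obtain ⟨⟨K, hK⟩, hlim⟩ := weibull_tailQuantile hF hc hα ha h
  have hr := coe_toReal_rightExt hF hc hK
  have hFr : F (rightExt F).toReal = 1 := by
    refine ((hF.le_one _).lt_or_eq).resolve_left fun h1 => ?_
    rw [← lt_rightExt_iff hF hc, hr] at h1
    exact lt_irrefl _ h1
  have hpos : ∀ᶠ n in atTop, 0 < (rightExt F).toReal - tailQuantile F (normingLevel k n) := by
    filter_upwards [(tendsto_normingLevel hk).eventually_gt_atTop 1] with n hn
    refine sub_pos.2 (hF.lt_of_apply_lt ?_)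
    rw [hFr]
    exact apply_tailQuantile_lt_one hF hc hn
  refine ⟨hr ▸ EReal.coe_lt_top _, hpos, fun x _ => ?_⟩
  rcases lt_or_ge x 0 with hx | hx
  · have := tendsto_upperU_pow hk (Real.rpow_pos_of_pos (abs_pos.2 hx.ne) _)
      ((hlim x hx).comp (tendsto_normingLevel hk))
    rw [← Real.rpow_natCast, ← Real.rpow_mul (abs_nonneg x), mul_comm α] at this
    rw [weibullDF_of_neg _ hx]
    exact this
  · rw [weibullDF, if_neg hx.not_gt]
    refine tendsto_const_nhds.congr' ?_
    filter_upwards [hpos] with n hn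
    have h1 : 1 ≤ F (((rightExt F).toReal - tailQuantile F (normingLevel k n)) * x
        + (rightExt F).toReal) := by
      rw [← hFr]
      exact hF.mono (by have := mul_nonneg hn.le hx; linarith)
    rw [upperU_eq, upperKernel_of_one_le k h1, one_pow]

theorem isAuxiliary_meanResidualLife (hF : IsDF F) (hc : Continuous F)
    (h : InMaxDomain F gumbelDF) :
    (∀ t : ℝ, IntegrableOn (fun s => 1 - F s) (Set.Ioi t)) ∧
      IsAuxiliary F (meanResidualLife F) := by
  obtain ⟨a, b, ha, h⟩ := h
  have H := h.tailScaling_gumbel hF ha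
  have hi := H.integrableOn_tail hF hc (locBounded_comp_floor a)
  refine ⟨hi, fun t ht => meanResidualLife_pos hF hc hi ((lt_rightExt_iff hF hc).1 ht),
    fun x _ => H.tendsto_tail_ratio hF hc (H.tendsto_meanResidualLife hF hc hi) x⟩

theorem areNormings_gumbel (hF : IsDF F) (hc : Continuous F) (hk : 1 ≤ k)
    (h : InMaxDomain F gumbelDF) {v : ℝ → ℝ} (hv : IsAuxiliary F v) :
    AreNormings (upperU F k) gumbelDF
      (fun n => v (genInv (upperU F k) (1 - 1 / (n : ℝ))) / (k : ℝ))
      (fun n => genInv (upperU F k) (1 - 1 / (n : ℝ))) := by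
  obtain ⟨a, b, ha, h⟩ := h
  have H := h.tailScaling_gumbel hF ha
  have hk0 : (0 : ℝ) < k := by exact_mod_cast hk
  have hU := hF.comp_upperKernel hc hk
  have hUc : Continuous (upperU F k) := (continuous_upperKernel hk).comp hc
  set B : ℕ → ℝ := fun n => genInv (upperU F k) (1 - 1 / (n : ℝ))
  have hB1 : ∀ᶠ n : ℕ in atTop, upperU F k (B n) = 1 - 1 / (n : ℝ) := by
    filter_upwards [eventually_gt_atTop 1] with n hn
    exact apply_tailQuantile hU hUc (by exact_mod_cast hn)
  have hBlt : ∀ᶠ n : ℕ in atTop, F (B n) < 1 := by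
    filter_upwards [hB1, eventually_gt_atTop 0] with n hn hn0
    rw [← upperKernel_lt_one_iff hk, ← upperU_eq, hn]
    have : (0 : ℝ) < 1 / n := by positivity
    linarith
  have hBr : Tendsto B atTop (toRightExt F) := by
    have e : toRightExt F = toRightExt (upperU F k) := by
      rw [toRightExt, toRightExt, rightExt_upperU F hk]
    rw [e, toRightExt_eq_comap hU hUc, tendsto_comap_iff]
    refine tendsto_nhdsWithin_iff.2 ⟨?_, ?_⟩
    · have := (tendsto_one_div_atTop_nhds_zero_nat (𝕜 := ℝ)).const_sub 1
      rw [sub_zero] at this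
      exact this.congr' (hB1.mono fun n hn => hn.symm)
    · filter_upwards [hBlt] with n hn
      exact upperKernel_lt_one hk hn
  refine ⟨?_, fun x _ => ?_⟩
  · filter_upwards [hBlt] with n hn
    exact div_pos (hv.1 _ ((lt_rightExt_iff hF hc).2 hn)) hk0
  · refine tendsto_pow_of_tendsto_nat_mul_one_sub ?_
    have ht := (tendsto_one_div_tail hF hc).comp hBr
    -- At x/k the F-tail ratio tends to e^{-x/k}, whose kth power is e^{-x}; hence the scale v/k.
    have hratio := (H.tendsto_tail_ratio hF hc (H.tendsto_auxiliary_div hF hc hv) (x / k)).comp hBr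
    have h1 := tendsto_tail_upperU hk (y := fun n => B n + v (B n) * (x / k)) ht
      (Real.exp_pos _) (hratio.congr fun n => by simp only [Function.comp_apply]; ring)
    have h2 := tendsto_tail_upperU hk (y := B) ht one_pos (tendsto_const_nhds.congr' (by
      filter_upwards [hBlt] with n hn
      exact (one_div_mul_cancel (sub_pos.2 hn).ne').symm))
    -- Dividing the limits cancels (k+1)! t^k; since 1 - U_k(b_n) = 1/n, the quotient is n times the
    -- tail of U_k.
    have h3 := h1.div h2 (by simp)
    have e : Real.exp (-(x / k)) ^ k / 1 ^ k = Real.exp (-x) := by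
      rw [one_pow, div_one, ← Real.exp_nat_mul]
      congr 1
      field_simp
    rw [e] at h3
    refine h3.congr' ?_
    filter_upwards [hB1, hBlt, eventually_gt_atTop 0] with n e1 e2 e3
    have hn : (n : ℝ) ≠ 0 := by positivity
    have hT := (sub_pos.2 e2).ne'
    have e4 : v (B n) / k * x + B n = B n + v (B n) * (x / k) := by ring
    have hfac : ((k + 1).factorial : ℝ) * ((fun t => 1 / (1 - F t)) ∘ B) n ^ k ≠ 0 := by
      simp only [Function.comp_apply]
      positivity
    simp only [Pi.div_apply]
    rw [mul_div_mul_left _ _ hfac, e1, e4, sub_sub_cancel, div_div_eq_mul_div, div_one, mul_comm]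

end Transfer

theorem mainTheorem8 (F f : ℝ → ℝ) (hF : IsDF F) (hf : IsPDFOf f F) (k : ℕ) (hk : 1 ≤ k) :
    -- (a)
    (IsDF (upperU F k) ∧ rightExt (upperU F k) = rightExt F ∧
      IsPDFOf (upperUDensity F f k) (upperU F k)) ∧
    -- (b)
    (Tendsto (fun x => (1 - upperU F k x) / (1 - F x) ^ k) (toRightExt F)
        (𝓝 (1 / ((k + 1).factorial : ℝ))) ∧
      TailEquivalent (upperU F k) (powTailDF F k)) ∧
    -- (c)
    (∀ α : ℝ, 0 < α → InMaxDomain F (frechetDF α) →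
      rightExt (upperU F k) = ⊤ ∧ rightExt F = ⊤ ∧
      InMaxDomain (upperU F k) (frechetDF (k * α)) ∧
      AreNormings (upperU F k) (frechetDF (k * α))
        (fun n => genInv F (1 - (((k + 1).factorial : ℝ) / (n : ℝ)) ^ (1 / (k : ℝ))))
        (fun _ => 0)) ∧
    -- (d)
    (∀ α : ℝ, 0 < α → InMaxDomain F (weibullDF α) →
      rightExt (upperU F k) = rightExt F ∧ rightExt F < ⊤ ∧
      InMaxDomain (upperU F k) (weibullDF (k * α)) ∧
      AreNormings (upperU F k) (weibullDF (k * α))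
        (fun n => (rightExt F).toReal
          - genInv F (1 - (((k + 1).factorial : ℝ) / (n : ℝ)) ^ (1 / (k : ℝ))))
        (fun _ => (rightExt F).toReal)) ∧
    -- (e)
    (InMaxDomain F gumbelDF →
      rightExt (upperU F k) = rightExt F ∧
      InMaxDomain (upperU F k) gumbelDF ∧
      (∀ v : ℝ → ℝ, IsAuxiliary F v →
        AreNormings (upperU F k) gumbelDF
          (fun n => v (genInv (upperU F k) (1 - 1 / (n : ℝ))) / (k : ℝ))
          (fun n => genInv (upperU F k) (1 - 1 / (n : ℝ)))) ∧
      (∀ t : ℝ, IntegrableOn (fun s => 1 - F s) (Set.Ioi t)) ∧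
      IsAuxiliary F (meanResidualLife F)) := by
  have hc := hf.continuous
  have hr := rightExt_upperU F hk
  simp_rw [tailQuantile_normingLevel]
  refine ⟨⟨hF.comp_upperKernel hc hk, hr, IsPDFOf.upperUDensity hF hf hk⟩,
    ⟨tendsto_tail_ratio_upperU hF hc hk, tailEquivalent_upperU_powTailDF hF hc hk⟩,
    fun α hα h => ?_, fun α hα h => ?_, fun h => ?_⟩
  · obtain ⟨h1, h2⟩ := areNormings_frechet hF hc hk hα h
    exact ⟨hr.trans h1, h1, h2.inMaxDomain, h2⟩
  · obtain ⟨h1, h2⟩ := areNormings_weibull hF hc hk hα h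
    exact ⟨hr, h1, h2.inMaxDomain, h2⟩
  · obtain ⟨h1, h2⟩ := isAuxiliary_meanResidualLife hF hc h
    exact ⟨hr, (areNormings_gumbel hF hc hk h h2).inMaxDomain,
      fun v hv => areNormings_gumbel hF hc hk h hv, h1, h2⟩
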